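/- \textbf{Fuzzy OSF term unification.} \emph{Setting.} A fuzzy partial order on a set $S$ is a map $\preceq\,:S\times S\to[0,1]$ with $\preceq(s,s)=1$, $\preceq(s,r)\ge\min(\preceq(s,t),\preceq(t,r))$, and $s=t$ whenever $\preceq(s,t)>0$ and $\preceq(t,s)>0$. A \emph{greatest lower bound} (GLB) of $a,b$ is an element $g$ with $\preceq(g,a)>0$ and $\preceq(g,b)>0$ such that $\preceq(c,g)>0$ for every $c$ with $\preceq(c,a)>0$ and $\preceq(c,b)>0$. Let $S$ be a finite set of sorts with a fuzzy partial order $\preceq$ in which any two sorts $s,s'$ have a GLB $s\curlywedge s'$, with sorts $\bot,\top$ such that $\preceq(\bot,s)=\preceq(s,\top)=1$ for all $s$; let $F$ be a set of features and $V$ a countably infinite set of variables (tags). \emph{Terms.} OSF terms are the expressions $t=X:s(f_1\to t_1,\dots,f_n\to t_n)$, $n\ge 0$, with root tag $\mathrm{root}(t)=X\in V$, $s\in S$, $f_i\in F$ and OSF terms $t_i$. Such a term is \emph{normal} if $s\ne\bot$, the $f_i$ are pairwise distinct, all $t_i$ are normal, and for each tag $Y$ there is at most one occurrence of $Y$ in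 $t$ as the root of a subterm different from $Y:\top$. \emph{Clauses.} A constraint is $X:s$, $X\doteq Y$ or $X.f\doteq Y$; a clause is a finite conjunction of constraints (up to associativity and commutativity of $\&$). The clause $\varphi(\psi)$ of a normal term $\psi$ consists of the constraints $X.f\doteq Y$ for every feature $f$ from a subterm with root $X$ to a subterm with root $Y$, and of one constraint $X:s$ for every tag $X$, where $s$ is the most specific sort such that $X:s$ appears in $\psi$. The normalization rules are \begin{itemize} \item $\varphi\,\&\,X:s\,\&\,X:s'\ \Longrightarrow\ \varphi\,\&\,X:s\curlywedge s'$; \item $\varphi\,\&\,X.f\doteq Y\,\&\,X.f\doteq Y'\ \Longrightarrow\ \varphi\,\&\,X.f\doteq Y\,\&\,Y\doteq Y'$; \item $\varphi\,\&\,X:\bot\ \Longrightarrow\ X:\bot$; \item $\varphi\,\&\,X\doteq Y\ \Longrightarrow\ \varphi[X/Y]\,\&\,X\doteq Y$, if $Y$ occurs in $\varphi$, where $\varphi[X/Y]$ replaces every $Y$ by $X$; \end{itemize} a rule instance that leaves the clause unchanged does not count as applicable. A clause is \emph{inconsistent} if it is $X:\bot$ for some $X$. $\mathrm{Solved}(\varphi)$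 is $\varphi$ without its constraints $X\doteq Y$. \emph{Semantics.} A fuzzy interpretation $\mathcal I$ is a set $\Delta$ with maps $s^{\mathcal I}:\Delta\to[0,1]$ ($s\in S$) and $f^{\mathcal I}:\Delta\to\Delta$ ($f\in F$) such that $\top^{\mathcal I}=1$, $\bot^{\mathcal I}=0$, $\min(s^{\mathcal I}(d),\preceq(s,s'))\le s'^{\mathcal I}(d)$, and $(s\curlywedge s')^{\mathcal I}(d)>0$ whenever $s^{\mathcal I}(d)>0$ and $s'^{\mathcal I}(d)>0$. For $\alpha:V\to\Delta$ and $t$ as above, $[\![t]\!]^{\mathcal I,\alpha}(d)$ is the minimum of $1$ or $0$ (according to whether $d=\alpha(X)$ or not), of $s^{\mathcal I}(d)$ and of the numbers $[\![t_i]\!]^{\mathcal I,\alpha}(f_i^{\mathcal I}(d))$; and $[\![t]\!]^{\mathcal I}(d)=\sup_\alpha[\![t]\!]^{\mathcal I,\alpha}(d)$. The fuzzy subsumption of terms is $$\preceq(t_1,t_2)=\sup\{\beta\in[0,1] : \min([\![t_1]\!]^{\mathcal I}(d),\beta)\le[\![t_2]\!]^{\mathcal I}(d)\ \text{for all }\mathcal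 I\text{ and all }d\}.$$ Terms are equivalent if they have the same denotation $[\![\cdot]\!]^{\mathcal I}$ in every $\mathcal I$. The \emph{fuzzy term lattice} consists of the normal terms and the terms $X:\bot$, with this relation; ``the'' GLB in it means a GLB to which every other GLB is equivalent. \emph{Theorem.} Let $\psi_1,\psi_2$ be normal OSF terms without common variables and let $\varphi_0=\varphi(\psi_1)\,\&\,\varphi(\psi_2)\,\&\,\mathrm{root}(\psi_1)\doteq\mathrm{root}(\psi_2)$. Every sequence of rule applications starting from $\varphi_0$ is finite. Let $\varphi$ be any clause obtained from $\varphi_0$ by applying rules, in any order, until none is applicable. Then: \begin{enumerate} \item for every tag $X$, $\varphi$ is inconsistent if and only if $X:\bot$ is the GLB of $\psi_1$ and $\psi_2$ in the fuzzy term lattice; \item if $\varphi$ is not inconsistent, then there is a normal term $\psi$ corresponding to $\mathrm{Solved}(\varphi)$, that is, with $\varphi(\psi)=\mathrm{Solved}(\varphi)$ and with a root tag that is equivalent to $\mathrm{root}(\psi_1)$ under the equivalence relation generated by the equality constraints of $\varphi$; and every such $\psi$ is the GLB of $\psi_1$ and $\psi_2$ in the fuzzy term lattice. \end{enumerate} 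-/

import Mathlib

universe u

namespace FuzzyOSF

/-- Given a fuzzy binary relation `R`, the element `g` is a greatest lower bound of `a` and `b`
among the elements of `P`: it is a lower bound (to a positive degree) of both, and every lower
bound in `P` lies below it (to a positive degree). -/
def IsFuzzyGLB {A : Type*} (R : A → A → unitInterval) (P : Set A) (a b g : A) : Prop :=
  g ∈ P ∧ 0 < R g a ∧ 0 < R g b ∧ ∀ c ∈ P, 0 < R c a → 0 < R c b → 0 < R c g

/-- A fuzzy bounded lattice: a fuzzy partial order (for the minimum t-norm) with a least and a
greatest element in which every pair of elements has a greatest lower bound. -/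
structure FuzzyLattice (S : Type u) where
  isa : S → S → unitInterval
  isa_refl : ∀ s, isa s s = 1
  isa_trans : ∀ s t r, isa s t ⊓ isa t r ≤ isa s r
  isa_antisymm : ∀ s t, 0 < isa s t → 0 < isa t s → s = t
  bot : S
  top : S
  bot_isa : ∀ s, isa bot s = 1
  isa_top : ∀ s, isa s top = 1
  exists_glb : ∀ s t, ∃ g, IsFuzzyGLB isa Set.univ s t g

/-- The greatest common subsort of two sorts (unique by antisymmetry). -/
noncomputable def FuzzyLattice.glb {S : Type u} (L : FuzzyLattice S) (s t : S) : S :=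
  (L.exists_glb s t).choose

/-! ### Terms -/

/-- OSF terms `X : s (f₁ → t₁, …, fₙ → tₙ)` with sorts in `S`, features in `F` and variables
(tags) in `V`; for `n = 0` this is the sorted variable `X : s`. -/
inductive OSFTerm (S F V : Type u) : Type u
  | mk (X : V) (s : S) (n : ℕ) (f : Fin n → F) (t : Fin n → OSFTerm S F V) : OSFTerm S F V

namespace OSFTerm

variable {S F V : Type u}

/-- The sorted variable `X : s`. -/
def leaf (X : V) (s : S) : OSFTerm S F V := mk X s 0 Fin.elim0 Fin.elim0

/-- The root tag. -/
def root : OSFTerm S F V → V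
  | mk X _ _ _ _ => X

/-- The set of tags occurring in a term. -/
def tags : OSFTerm S F V → Set V
  | mk X _ _ _ t => {X} ∪ ⋃ i, tags (t i)

/-- The subterms of a term, one for each occurrence of a tag (hence with multiplicity). -/
def subterms : OSFTerm S F V → Multiset (OSFTerm S F V)
  | mk X s n f t => mk X s n f t ::ₘ ∑ i, subterms (t i)

open Classical in
/-- Normal OSF terms (`ψ`-terms). In the last clause, the occurrences of `Y` at which a term
different from `Y : ⊤` is rooted are counted. -/
def Normal (L : FuzzyLattice S) : OSFTerm S F V → Prop
  | mk X s n f t =>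
      s ≠ L.bot ∧ Function.Injective f ∧ (∀ i, Normal L (t i)) ∧
      ∀ Y, Multiset.card ((subterms (mk X s n f t)).filter
        (fun r => root r = Y ∧ r ≠ leaf Y L.top)) ≤ 1

end OSFTerm

/-! ### Constraints, clauses and the normalization rules -/

/-- OSF constraints `X : s`, `X ≐ Y` and `X.f ≐ Y`. -/
inductive OSFConstraint (S F V : Type u) : Type u
  | sort (X : V) (s : S) : OSFConstraint S F V
  | eq (X Y : V) : OSFConstraint S F V
  | feat (X : V) (f : F) (Y : V) : OSFConstraint S F V

namespace OSFConstraint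

variable {S F V : Type u}

/-- The variables of a constraint. -/
def tags : OSFConstraint S F V → Set V
  | sort X _ => {X}
  | eq X Y => {X, Y}
  | feat X _ Y => {X, Y}

/-- Renaming of the variables of a constraint. -/
def rename (ρ : V → V) : OSFConstraint S F V → OSFConstraint S F V
  | sort X s => sort (ρ X) s
  | eq X Y => eq (ρ X) (ρ Y)
  | feat X f Y => feat (ρ X) f (ρ Y)

/-- The constraint is an equality constraint between variables. -/
def IsEq : OSFConstraint S F V → Prop
  | eq _ _ => True
  | _ => False

end OSFConstraint

/-- An OSF clause is a finite conjunction of constraints, up to associativity and commutativity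
of the conjunction; the conjunction of two clauses is their sum. -/
abbrev OSFClause (S F V : Type u) : Type u := Multiset (OSFConstraint S F V)

namespace OSFClause

variable {S F V : Type u}

/-- The variables of a clause. -/
def tags (c : OSFClause S F V) : Set V := {X | ∃ k ∈ c, X ∈ k.tags}

open Classical in
/-- `c.subst X Y` is `c[X/Y]`: all occurrences of `Y` are replaced with `X`. -/
noncomputable def subst (c : OSFClause S F V) (X Y : V) : OSFClause S F V :=
  c.map (OSFConstraint.rename (Function.update id Y X))

/-- The inconsistent clause `X : ⊥`. -/
def Inconsistent (L : FuzzyLattice S) (c : OSFClause S F V) : Prop :=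
  ∃ X, c = {OSFConstraint.sort X L.bot}

open Classical in
/-- The subclause without the equality constraints. -/
noncomputable def solved (c : OSFClause S F V) : OSFClause S F V :=
  c.filter (fun k => ¬ k.IsEq)

/-- The equivalence relation on variables that is generated by the equality constraints of a
clause. -/
def EqTags (c : OSFClause S F V) : V → V → Prop :=
  Relation.EqvGen (fun X Y => OSFConstraint.eq X Y ∈ c)

/-- The fuzzy OSF constraint normalization rules (premise, conclusion). -/
inductive Rule (L : FuzzyLattice S) : OSFClause S F V → OSFClause S F V → Prop
  | sortIntersection (c : OSFClause S F V) (X : V) (s s' : S) :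
      Rule L (c + {.sort X s} + {.sort X s'}) (c + {.sort X (L.glb s s')})
  | featureFunctionality (c : OSFClause S F V) (X : V) (f : F) (Y Y' : V) :
      Rule L (c + {.feat X f Y} + {.feat X f Y'}) (c + {.feat X f Y} + {.eq Y Y'})
  | inconsistentSort (c : OSFClause S F V) (X : V) :
      Rule L (c + {.sort X L.bot}) {.sort X L.bot}
  | tagElimination (c : OSFClause S F V) (X Y : V) (hY : Y ∈ c.tags) :
      Rule L (c + {.eq X Y}) (c.subst X Y + {.eq X Y})

/-- A normalization step: the application of a rule that changes the clause. (The instances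
that leave the clause as it is, namely `X : ⊥ ⟹ X : ⊥` and tag elimination for `X ≐ X`, do not
count as applicable.) -/
def Step (L : FuzzyLattice S) (c c' : OSFClause S F V) : Prop :=
  Rule L c c' ∧ c' ≠ c

/-- `c'` is obtained from `c` by applying normalization rules until none is applicable. -/
def NormalizesTo (L : FuzzyLattice S) (c c' : OSFClause S F V) : Prop :=
  Relation.ReflTransGen (Step L) c c' ∧ ∀ c'', ¬ Step L c' c''

/-- Every sequence of normalization steps starting from `c` is finite. -/
def Terminates (L : FuzzyLattice S) (c : OSFClause S F V) : Prop :=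
  ¬ ∃ σ : ℕ → OSFClause S F V, σ 0 = c ∧ ∀ n, Step L (σ n) (σ (n + 1))

end OSFClause

namespace OSFTerm

variable {S F V : Type u}

/-- All the constraints expressed by an OSF term: `X : s` for each subterm with root `X` and
root sort `s`, and `X.f ≐ Y` for each feature `f` from a subterm with root `X` to a subterm with
root `Y`. -/
def constraints : OSFTerm S F V → OSFClause S F V
  | mk X s _ f t =>
      {.sort X s} + ∑ i, ({.feat X (f i) (root (t i))} + constraints (t i))

open Classical in
/-- The clause `φ(ψ)` of a normal term `ψ`: the feature constraints of `ψ`, together with, for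
each tag `X` of `ψ`, the one constraint `X : s` where `s` is the most specific sort such that
`X : s` appears in `ψ`. (So `X : ⊤` is dropped if `X` has another sort elsewhere in `ψ`.) -/
noncomputable def clause (L : FuzzyLattice S) (ψ : OSFTerm S F V) : OSFClause S F V :=
  (constraints ψ).dedup.filter (fun k => ∀ X s, k = .sort X s →
    ∀ s', OSFConstraint.sort X s' ∈ constraints ψ → 0 < L.isa s s')

end OSFTerm

/-! ### Semantics -/

/-- Fuzzy OSF interpretations (algebras) for the sorts `S` ordered by `L` and the features `F`.
-/
structure Interpretation {S : Type u} (L : FuzzyLattice S) (F : Type u) where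
  Dom : Type u
  sort : S → Dom → unitInterval
  feat : F → Dom → Dom
  sort_top : ∀ d, sort L.top d = 1
  sort_bot : ∀ d, sort L.bot d = 0
  sort_isa : ∀ s s' d, sort s d ⊓ L.isa s s' ≤ sort s' d
  sort_glb : ∀ s s' d, 0 < sort s d ⊓ sort s' d → 0 < sort (L.glb s s') d

namespace OSFTerm

variable {S F V : Type u} {L : FuzzyLattice S}

open Classical in
/-- The denotation of a term in an interpretation under an assignment. -/
noncomputable def denotationAt (I : Interpretation L F) (α : V → I.Dom) :
    OSFTerm S F V → I.Dom → unitInterval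
  | mk X s _ f t, d =>
      (if d = α X then 1 else 0) ⊓ I.sort s d ⊓
        Finset.univ.inf (fun i => denotationAt I α (t i) (I.feat (f i) d))

/-- The denotation of a term in an interpretation. -/
noncomputable def denotation (I : Interpretation L F) (t : OSFTerm S F V) (d : I.Dom) :
    unitInterval :=
  ⨆ α : V → I.Dom, denotationAt I α t d

variable (L)

/-- The (semantic) fuzzy subsumption degree of `t₁` with respect to `t₂`. -/
noncomputable def subsumption (t₁ t₂ : OSFTerm S F V) : unitInterval :=
  sSup {β | ∀ (I : Interpretation L F) (d : I.Dom),
    denotation I t₁ d ⊓ β ≤ denotation I t₂ d}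

/-- Two terms are equivalent if they have the same denotation in every interpretation. -/
def Equivalent (t₁ t₂ : OSFTerm S F V) : Prop :=
  ∀ (I : Interpretation L F) (d : I.Dom), denotation I t₁ d = denotation I t₂ d

/-- The elements of the fuzzy term lattice: the normal terms and the bottom terms `X : ⊥`. -/
def latticeTerms : Set (OSFTerm S F V) := {t | t.Normal L ∨ ∃ X, t = leaf X L.bot}

/-- `t` is the greatest lower bound of `ψ₁` and `ψ₂` in the fuzzy term lattice, i.e. the one
such bound up to equivalence of terms. -/
def IsUnifier (ψ₁ ψ₂ t : OSFTerm S F V) : Prop :=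
  IsFuzzyGLB (subsumption L) (latticeTerms L) ψ₁ ψ₂ t ∧
    ∀ t', IsFuzzyGLB (subsumption L) (latticeTerms L) ψ₁ ψ₂ t' → Equivalent L t' t

/-- The clause `φ(ψ₁) & φ(ψ₂) & root(ψ₁) ≐ root(ψ₂)`. -/
noncomputable def unificationClause (ψ₁ ψ₂ : OSFTerm S F V) : OSFClause S F V :=
  clause L ψ₁ + clause L ψ₂ + {.eq (root ψ₁) (root ψ₂)}

/-- `ψ` is a normal term corresponding to the clause `solved c`, rooted at the tag that
represents the tag `X` according to the equality constraints of `c`. -/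
def IsTermOfSolved (c : OSFClause S F V) (X : V) (ψ : OSFTerm S F V) : Prop :=
  ψ.Normal L ∧ clause L ψ = c.solved ∧ c.EqTags X (root ψ)

end OSFTerm

end FuzzyOSF

/-! Positive subsumption is a homomorphism problem. The tags of a normal term `t₁`, continued by
free feature paths, form the interpretation `canonical t₁`, and any solution of the constraints of
`t₁` extends to a feature-preserving map out of it. Hence `t₁` lies below `t₂` to a positive degree
iff the constraints of `t₂` have a positive solution in `canonical t₁` that sends root to root
(`subsumption_pos_iff`). If two normal terms subsume each other positively, antisymmetry of the sort
order raises the degrees to 1, so greatest lower bounds are unique up to equivalence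
(`isUnifier_of_isFuzzyGLB`).

The rules preserve positive solutions (`Rule.sat_iff`). Since `ψ₁` and `ψ₂` share no tags, a normal
common lower bound `t` yields a solution of the unification clause in `canonical t`, hence one of
the normal form `φ`. If `φ` is `X : ⊥`, there is no such `t`. Otherwise a term `ψ` with clause
`Solved(φ)` solves `φ` in its own canonical interpretation, so it is a lower bound; and a solution
of `φ` in `canonical t` puts `t` below `ψ`.

Such a `ψ` exists because `Solved(φ)` is a finite deterministic graph with one sort per tag,
reachable from the representative of the root; a depth-first traversal unfolds it, writing revisited
tags as `Y : ⊤` (`exists_clause_eq`). Termination follows from a lexicographic measure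
(`Step.measure_lt`). -/

namespace FuzzyOSF

/-! ### Sorts, tags and constraints of normal terms. -/

namespace FuzzyLattice

variable {S : Type u} (L : FuzzyLattice S)

theorem glb_spec (s t : S) : IsFuzzyGLB L.isa Set.univ s t (L.glb s t) :=
  (L.exists_glb s t).choose_spec

theorem eq_top_of_isa_pos {s : S} (h : 0 < L.isa L.top s) : s = L.top :=
  L.isa_antisymm _ _ (by rw [L.isa_top]; exact zero_lt_one) h

theorem eq_bot_of_isa_pos {s : S} (h : 0 < L.isa s L.bot) : s = L.bot :=
  L.isa_antisymm _ _ h (by rw [L.bot_isa]; exact zero_lt_one)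

theorem top_ne_bot_of_ne {s : S} (h : s ≠ L.bot) : L.top ≠ L.bot := fun e =>
  h (L.eq_bot_of_isa_pos (by rw [← e, L.isa_top]; exact zero_lt_one))

end FuzzyLattice

namespace OSFTerm

variable {S F V : Type u}

/-- The sort at the root of a term. -/
def rootSort : OSFTerm S F V → S
  | mk _ s _ _ _ => s

theorem sort_mem_constraints {t : OSFTerm S F V} {X : V} {s : S} :
    OSFConstraint.sort X s ∈ constraints t ↔ ∃ r ∈ subterms t, r.root = X ∧ r.rootSort = s := by
  induction t with
  | mk Y s' n f t ih =>
    simp only [constraints, subterms, Multiset.mem_add, Multiset.mem_singleton,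
      Multiset.mem_sum, Finset.mem_univ, true_and, ih, Multiset.mem_cons, reduceCtorEq, false_or,
      OSFConstraint.sort.injEq]
    constructor
    · rintro (⟨rfl, rfl⟩ | ⟨i, r, hr, h⟩)
      · exact ⟨_, Or.inl rfl, rfl, rfl⟩
      · exact ⟨r, Or.inr ⟨i, hr⟩, h⟩
    · rintro ⟨r, rfl | ⟨i, hr⟩, h⟩
      · exact Or.inl ⟨h.1.symm, h.2.symm⟩
      · exact Or.inr ⟨i, r, hr, h⟩

theorem feat_mem_constraints {t : OSFTerm S F V} {X Y : V} {f : F} :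
    OSFConstraint.feat X f Y ∈ constraints t ↔
      ∃ (s : S) (n : ℕ) (g : Fin n → F) (u : Fin n → OSFTerm S F V) (i : Fin n),
        mk X s n g u ∈ subterms t ∧ g i = f ∧ (u i).root = Y := by
  induction t with
  | mk Z s' n g t ih =>
    simp only [constraints, subterms, Multiset.mem_add, Multiset.mem_singleton,
      Multiset.mem_sum, Finset.mem_univ, true_and, ih, Multiset.mem_cons, reduceCtorEq, false_or,
      OSFConstraint.feat.injEq]
    constructor
    · rintro ⟨i, ⟨rfl, rfl, rfl⟩ | ⟨s, m, g', u, j, hr, h⟩⟩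
      · exact ⟨_, _, _, _, i, Or.inl rfl, rfl, rfl⟩
      · exact ⟨s, m, g', u, j, Or.inr ⟨i, hr⟩, h⟩
    · rintro ⟨s, m, g', u, j, h | ⟨i, hr⟩, h'⟩
      · cases h
        exact ⟨j, Or.inl ⟨rfl, h'.1.symm, h'.2.symm⟩⟩
      · exact ⟨i, Or.inr ⟨s, m, g', u, j, hr, h'⟩⟩

theorem eq_notMem_constraints (t : OSFTerm S F V) (X Y : V) :
    OSFConstraint.eq X Y ∉ constraints t := by
  induction t with
  | mk Z s' n g t ih =>
    simp [constraints, Multiset.mem_sum, ih]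

theorem root_mem_tags (t : OSFTerm S F V) : t.root ∈ t.tags := by
  cases t; simp [tags, root]

theorem mem_tags_iff {t : OSFTerm S F V} {X : V} : X ∈ tags t ↔ ∃ r ∈ subterms t, r.root = X := by
  induction t with
  | mk Y s n f t ih =>
    simp only [tags, subterms, Set.mem_union, Set.mem_singleton_iff, Set.mem_iUnion, ih,
      Multiset.mem_cons, Multiset.mem_sum, Finset.mem_univ, true_and]
    constructor
    · rintro (rfl | ⟨i, r, hr, h⟩)
      · exact ⟨_, Or.inl rfl, rfl⟩
      · exact ⟨r, Or.inr ⟨i, hr⟩, h⟩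
    · rintro ⟨r, rfl | ⟨i, hr⟩, h⟩
      · exact Or.inl h.symm
      · exact Or.inr ⟨i, r, hr, h⟩

theorem exists_sort_mem_constraints {t : OSFTerm S F V} {X : V} (h : X ∈ tags t) :
    ∃ s, OSFConstraint.sort X s ∈ constraints t := by
  obtain ⟨r, hr, h⟩ := mem_tags_iff.1 h
  exact ⟨_, sort_mem_constraints.2 ⟨r, hr, h, rfl⟩⟩

theorem tags_subset_of_mem_constraints {t : OSFTerm S F V} {k : OSFConstraint S F V}
    (hk : k ∈ constraints t) : k.tags ⊆ tags t := by
  induction t with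
  | mk Y s n f t ih =>
    simp only [constraints, Multiset.mem_add, Multiset.mem_singleton, Multiset.mem_sum,
      Finset.mem_univ, true_and] at hk
    rcases hk with rfl | ⟨i, rfl | hk⟩
    · simp [OSFConstraint.tags, tags]
    · rintro Z (rfl | rfl)
      · simp [tags]
      · exact Or.inr (Set.mem_iUnion.2 ⟨i, root_mem_tags _⟩)
    · exact (ih i hk).trans fun Z hZ => Or.inr (Set.mem_iUnion.2 ⟨i, hZ⟩)

/-- Every tag of a term is reachable from its root along the feature constraints. -/
theorem tags_induction (t : OSFTerm S F V) (P : V → Prop) (h0 : P t.root)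
    (h : ∀ X f Y, OSFConstraint.feat X f Y ∈ constraints t → P X → P Y) : ∀ X ∈ tags t, P X := by
  induction t with
  | mk Y s n f t ih =>
    intro X hX
    rcases hX with rfl | hX
    · exact h0
    · obtain ⟨i, hX⟩ := Set.mem_iUnion.1 hX
      refine ih i (h Y (f i) _ ?_ h0) (fun X g Z hk => h X g Z ?_) X hX
      · exact Multiset.mem_add.2 (Or.inr (Multiset.mem_sum.2
          ⟨i, Finset.mem_univ _, Multiset.mem_add.2 (Or.inl (Multiset.mem_singleton_self _))⟩))
      · exact Multiset.mem_add.2 (Or.inr (Multiset.mem_sum.2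
          ⟨i, Finset.mem_univ _, Multiset.mem_add.2 (Or.inr hk)⟩))

section Normal

variable {L : FuzzyLattice S} {t : OSFTerm S F V}

theorem Normal.of_mem_subterms (h : t.Normal L) {r : OSFTerm S F V} (hr : r ∈ subterms t) :
    r.Normal L := by
  induction t with
  | mk Y s n f t ih =>
    simp only [subterms, Multiset.mem_cons, Multiset.mem_sum, Finset.mem_univ, true_and] at hr
    rcases hr with rfl | ⟨i, hr⟩
    · exact h
    · rw [Normal] at h
      exact ih i (h.2.2.1 i) hr

theorem Normal.rootSort_ne_bot (h : t.Normal L) : t.rootSort ≠ L.bot := by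
  cases t
  rw [Normal] at h
  exact h.1

theorem Normal.top_ne_bot (h : t.Normal L) : L.top ≠ L.bot :=
  L.top_ne_bot_of_ne h.rootSort_ne_bot

theorem Normal.sort_ne_bot (h : t.Normal L) {X : V} {s : S}
    (hk : OSFConstraint.sort X s ∈ constraints t) : s ≠ L.bot := by
  obtain ⟨r, hr, -, rfl⟩ := sort_mem_constraints.1 hk
  exact (h.of_mem_subterms hr).rootSort_ne_bot

/-- Two distinct such subterms would be two elements of a multiset that normality bounds by one. -/
theorem Normal.subterm_eq (h : t.Normal L) {r r' : OSFTerm S F V} (hr : r ∈ subterms t)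
    (hr' : r' ∈ subterms t) (e : r.root = r'.root) (hl : r ≠ leaf r.root L.top)
    (hl' : r' ≠ leaf r'.root L.top) : r = r' := by
  classical
  have hc : Multiset.card ((subterms t).filter
      (fun q => root q = r.root ∧ q ≠ leaf r.root L.top)) ≤ 1 := by
    cases t
    rw [Normal] at h
    convert h.2.2.2 r.root
  by_contra hne
  have hle : ({r, r'} : Multiset (OSFTerm S F V)) ≤ (subterms t).filter
      (fun q => root q = r.root ∧ q ≠ leaf r.root L.top) := by
    rw [Multiset.le_iff_subset (by simp [hne])]
    intro q hq
    simp only [Multiset.insert_eq_cons, Multiset.mem_cons, Multiset.mem_singleton] at hq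
    rw [Multiset.mem_filter]
    rcases hq with rfl | rfl
    · exact ⟨hr, rfl, hl⟩
    · exact ⟨hr', e.symm, by rw [e]; exact hl'⟩
  have := (Multiset.card_le_card hle).trans hc
  simp at this

theorem Normal.sort_unique (h : t.Normal L) {X : V} {s s' : S}
    (hs : OSFConstraint.sort X s ∈ constraints t) (hs' : OSFConstraint.sort X s' ∈ constraints t)
    (hne : s ≠ L.top) (hne' : s' ≠ L.top) : s = s' := by
  obtain ⟨r, hr, rfl, rfl⟩ := sort_mem_constraints.1 hs
  obtain ⟨r', hr', e, rfl⟩ := sort_mem_constraints.1 hs'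
  rw [h.subterm_eq hr hr' e.symm (fun h => hne (by rw [h]; rfl)) (fun h => hne' (by rw [h]; rfl))]

theorem Normal.feat_unique (h : t.Normal L) {X Y Y' : V} {f : F}
    (hk : OSFConstraint.feat X f Y ∈ constraints t)
    (hk' : OSFConstraint.feat X f Y' ∈ constraints t) : Y = Y' := by
  obtain ⟨s, n, g, u, i, hr, rfl, rfl⟩ := feat_mem_constraints.1 hk
  obtain ⟨s', n', g', u', i', hr', e, rfl⟩ := feat_mem_constraints.1 hk'
  have key : ∀ (s : S) (n : ℕ) (g : Fin n → F) (u : Fin n → OSFTerm S F V) (_ : Fin n),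
      mk X s n g u ≠ leaf (mk X s n g u).root L.top := by
    intro s n g u i e
    simp only [leaf, root, mk.injEq] at e
    obtain ⟨-, -, rfl, -⟩ := e
    exact i.elim0
  have := h.subterm_eq hr hr' rfl (key _ _ _ _ i) (key _ _ _ _ i')
  cases this
  have hn := h.of_mem_subterms hr
  rw [Normal] at hn
  rw [hn.2.1 e]

open Classical in
/-- The most specific sort of a tag in a term. -/
noncomputable def nodeSort (L : FuzzyLattice S) (t : OSFTerm S F V) (X : V) : S :=
  if h : ∃ s, OSFConstraint.sort X s ∈ constraints t ∧ s ≠ L.top then h.choose else L.top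

/-- This needs no assumption that `X` occurs in `t`: the default value of `nodeSort` is `⊤`. -/
theorem nodeSort_eq_top_or (L : FuzzyLattice S) (t : OSFTerm S F V) (X : V) :
    nodeSort L t X = L.top ∨ OSFConstraint.sort X (nodeSort L t X) ∈ constraints t := by
  rw [nodeSort]
  split_ifs with h
  · exact Or.inr h.choose_spec.1
  · exact Or.inl rfl

theorem Normal.sort_eq (h : t.Normal L) {X : V} {s : S}
    (hs : OSFConstraint.sort X s ∈ constraints t) : s = L.top ∨ s = nodeSort L t X := by
  by_cases hne : s = L.top
  · exact Or.inl hne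
  · right
    have hex : ∃ s, OSFConstraint.sort X s ∈ constraints t ∧ s ≠ L.top := ⟨s, hs, hne⟩
    rw [nodeSort, dif_pos hex]
    exact h.sort_unique hs hex.choose_spec.1 hne hex.choose_spec.2

theorem nodeSort_mem {X : V} (hX : X ∈ tags t) :
    OSFConstraint.sort X (nodeSort L t X) ∈ constraints t := by
  rw [nodeSort]
  split_ifs with h
  · exact h.choose_spec.1
  · obtain ⟨s, hs⟩ := exists_sort_mem_constraints hX
    by_cases hne : s = L.top
    · exact hne ▸ hs
    · exact absurd ⟨s, hs, hne⟩ h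

theorem Normal.nodeSort_ne_bot (h : t.Normal L) (X : V) : nodeSort L t X ≠ L.bot := by
  rcases nodeSort_eq_top_or L t X with e | e
  · rw [e]; exact h.top_ne_bot
  · exact h.sort_ne_bot e

theorem sort_mem_clause (h : t.Normal L) {X : V} {s : S} :
    OSFConstraint.sort X s ∈ clause L t ↔ X ∈ tags t ∧ s = nodeSort L t X := by
  classical
  simp only [clause, Multiset.mem_filter, Multiset.mem_dedup, OSFConstraint.sort.injEq]
  constructor
  · rintro ⟨hs, hm⟩
    have hX : X ∈ tags t := tags_subset_of_mem_constraints hs rfl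
    refine ⟨hX, ?_⟩
    rcases h.sort_eq hs with rfl | e
    -- If `⊤` survives the filter, it lies below the most specific sort, which is then `⊤` itself.
    · exact (L.eq_top_of_isa_pos (hm X _ ⟨rfl, rfl⟩ _ (nodeSort_mem hX))).symm
    · exact e
  · rintro ⟨hX, rfl⟩
    refine ⟨nodeSort_mem hX, ?_⟩
    rintro _ _ ⟨rfl, rfl⟩ s' hs'
    rcases h.sort_eq hs' with rfl | rfl
    · rw [L.isa_top]; exact zero_lt_one
    · rw [L.isa_refl]; exact zero_lt_one

theorem feat_mem_clause {X Y : V} {f : F} :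
    OSFConstraint.feat X f Y ∈ clause L t ↔ OSFConstraint.feat X f Y ∈ constraints t := by
  classical
  simp [clause]

theorem mem_constraints_of_mem_clause {k : OSFConstraint S F V} (hk : k ∈ clause L t) :
    k ∈ constraints t := by
  classical
  exact Multiset.mem_dedup.1 (Multiset.mem_filter.1 hk).1

theorem nodup_clause (L : FuzzyLattice S) (t : OSFTerm S F V) : (clause L t).Nodup := by
  classical
  exact (Multiset.nodup_dedup _).filter _

end Normal

end OSFTerm

/-! ### Degrees of constraints and denotations of terms. -/

namespace OSFConstraint

variable {S F V : Type u} {L : FuzzyLattice S}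

open Classical in
/-- The degree to which an assignment satisfies a constraint. -/
noncomputable def degree (I : Interpretation L F) (α : V → I.Dom) :
    OSFConstraint S F V → unitInterval
  | sort X s => I.sort s (α X)
  | eq X Y => if α X = α Y then 1 else 0
  | feat X f Y => if I.feat f (α X) = α Y then 1 else 0

theorem le_ite_iff {v : unitInterval} (hv : 0 < v) (p : Prop) [Decidable p] :
    v ≤ (if p then 1 else 0) ↔ p := by
  split_ifs with h
  · simp [h, unitInterval.le_one']
  · simp [h, hv.ne']

theorem degree_congr {I : Interpretation L F} {α β : V → I.Dom} {k : OSFConstraint S F V}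
    (h : ∀ X ∈ k.tags, α X = β X) : degree I α k = degree I β k := by
  cases k with
  | sort X s => simp [degree, h X rfl]
  | eq X Y => rw [degree, degree, h X (Or.inl rfl), h Y (Or.inr rfl)]
  | feat X f Y => rw [degree, degree, h X (Or.inl rfl), h Y (Or.inr rfl)]

theorem degree_eq_pos {I : Interpretation L F} {α : V → I.Dom} {X Y : V} :
    0 < degree I α (eq X Y : OSFConstraint S F V) ↔ α X = α Y := by
  rw [degree]
  split_ifs with h <;> simp [h]

theorem degree_feat_pos {I : Interpretation L F} {α : V → I.Dom} {X Y : V} {f : F} :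
    0 < degree I α (feat X f Y : OSFConstraint S F V) ↔ I.feat f (α X) = α Y := by
  rw [degree]
  split_ifs with h <;> simp [h]

end OSFConstraint

namespace OSFTerm

variable {S F V : Type u} {L : FuzzyLattice S}

open OSFConstraint

/-- A minimum is at least `v` iff all its entries are. Positivity of `v` turns the two-valued tag
conditions into equations, which are the feature constraints. -/
theorem le_denotationAt_iff {I : Interpretation L F} {α : V → I.Dom} {v : unitInterval}
    (hv : 0 < v) (t : OSFTerm S F V) (d : I.Dom) :
    v ≤ denotationAt I α t d ↔ d = α t.root ∧ ∀ k ∈ constraints t, v ≤ degree I α k := by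
  induction t generalizing d with
  | mk X s n f t ih =>
    rw [denotationAt, le_inf_iff, le_inf_iff, le_ite_iff hv, Finset.le_inf_iff]
    simp only [Finset.mem_univ, true_imp_iff, ih, root, constraints, Multiset.mem_add,
      Multiset.mem_singleton, Multiset.mem_sum, true_and]
    constructor
    · rintro ⟨⟨rfl, hs⟩, h⟩
      refine ⟨rfl, ?_⟩
      rintro k (rfl | ⟨i, rfl | hk⟩)
      · exact hs
      · rw [degree, le_ite_iff hv]
        exact (h i).1
      · exact (h i).2 k hk
    · rintro ⟨rfl, h⟩
      refine ⟨⟨rfl, h _ (Or.inl rfl)⟩, fun i => ⟨?_, fun k hk => h k (Or.inr ⟨i, Or.inr hk⟩)⟩⟩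
      have := h _ (Or.inr ⟨i, Or.inl rfl⟩)
      rwa [degree, le_ite_iff hv] at this

theorem lt_denotation_iff {I : Interpretation L F} {t : OSFTerm S F V} {d : I.Dom}
    {v : unitInterval} : v < denotation I t d ↔ ∃ α, v < denotationAt I α t d :=
  lt_iSup_iff

end OSFTerm

namespace OSFClause

variable {S F V : Type u} {L : FuzzyLattice S}

open OSFConstraint

/-- The assignment satisfies all the constraints of the clause to a positive degree. -/
def Sat (I : Interpretation L F) (α : V → I.Dom) (c : OSFClause S F V) : Prop :=
  ∀ k ∈ c, 0 < degree I α k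

theorem sat_add {I : Interpretation L F} {α : V → I.Dom} {c c' : OSFClause S F V} :
    Sat I α (c + c') ↔ Sat I α c ∧ Sat I α c' := by
  simp [Sat, or_imp, forall_and]

theorem sat_singleton {I : Interpretation L F} {α : V → I.Dom} {k : OSFConstraint S F V} :
    Sat I α {k} ↔ 0 < degree I α k := by
  simp [Sat]

end OSFClause

namespace OSFTerm

variable {S F V : Type u} {L : FuzzyLattice S}

open OSFConstraint OSFClause

theorem denotationAt_pos_iff {I : Interpretation L F} {α : V → I.Dom} (t : OSFTerm S F V)
    (d : I.Dom) :
    0 < denotationAt I α t d ↔ d = α t.root ∧ Sat I α (constraints t) := by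
  constructor
  · intro h
    obtain ⟨h1, h2⟩ := (le_denotationAt_iff h t d).1 le_rfl
    exact ⟨h1, fun k hk => h.trans_le (h2 k hk)⟩
  · rintro ⟨h1, h2⟩
    classical
    -- A clause is finite, so positive degrees have a positive common lower bound.
    obtain ⟨v, hv, hv'⟩ : ∃ v : unitInterval, 0 < v ∧ ∀ k ∈ constraints t, v ≤ degree I α k := by
      generalize constraints t = c at h2
      induction c using Multiset.induction with
      | empty => exact ⟨1, zero_lt_one, by simp⟩
      | cons k c ih =>
        obtain ⟨v, hv, hv'⟩ := ih fun k' hk' => h2 k' (Multiset.mem_cons_of_mem hk')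
        refine ⟨v ⊓ degree I α k, lt_inf_iff.2 ⟨hv, h2 k (Multiset.mem_cons_self _ _)⟩, ?_⟩
        intro k' hk'
        rcases Multiset.mem_cons.1 hk' with rfl | hk'
        · exact inf_le_right
        · exact inf_le_left.trans (hv' k' hk')
    exact hv.trans_le ((le_denotationAt_iff hv t d).2 ⟨h1, hv'⟩)

theorem denotation_pos_iff {I : Interpretation L F} {t : OSFTerm S F V} {d : I.Dom} :
    0 < denotation I t d ↔ ∃ α : V → I.Dom, d = α t.root ∧ Sat I α (constraints t) := by
  simp only [lt_denotation_iff, denotationAt_pos_iff]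

/-- The constraints dropped by `clause` have sort `⊤` and are satisfied to degree 1. -/
theorem sat_clause_iff {I : Interpretation L F} {α : V → I.Dom} {t : OSFTerm S F V}
    (h : t.Normal L) : Sat I α (clause L t) ↔ Sat I α (constraints t) := by
  constructor
  · intro hs k hk
    cases k with
    | sort X s =>
      rcases h.sort_eq hk with rfl | rfl
      · rw [degree, I.sort_top]; exact zero_lt_one
      · exact hs _ ((sort_mem_clause h).2 ⟨tags_subset_of_mem_constraints hk rfl, rfl⟩)
    | eq X Y => exact absurd hk (eq_notMem_constraints t X Y)
    | feat X f Y => exact hs _ (feat_mem_clause.2 hk)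
  · exact fun hs k hk => hs k (mem_constraints_of_mem_clause hk)

end OSFTerm

end FuzzyOSF

/-! ### The canonical interpretation and positive subsumption. -/

namespace FuzzyOSF

namespace OSFTerm

variable {S F V : Type u} {L : FuzzyLattice S}

open OSFConstraint OSFClause

open Classical in
/-- The features of the canonical interpretation of a term: the elements are tags followed by a
path of features that leaves the term. -/
noncomputable def canonicalFeat (t : OSFTerm S F V) (f : F) : V × List F → V × List F
  | (X, []) => if h : ∃ Y, feat X f Y ∈ constraints t then (h.choose, []) else (X, [f])
  | (X, g :: l) => (X, f :: g :: l)

/-- The most specific sort of an element of the canonical interpretation of a term. -/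
noncomputable def canonicalSort (L : FuzzyLattice S) (t : OSFTerm S F V) : V × List F → S
  | (X, []) => nodeSort L t X
  | (_, _ :: _) => L.top

/-- The canonical interpretation of a normal term. -/
@[reducible] noncomputable def canonical (t : OSFTerm S F V) (h : t.Normal L) : Interpretation L F where
  Dom := V × List F
  -- Measuring a sort by its distance above the node's own sort turns the axioms of interpretations
  -- into order axioms. Normality enters only in `sort_bot`, since no node may carry `⊥`.
  sort s d := L.isa (canonicalSort L t d) s
  feat := canonicalFeat t
  sort_top _ := L.isa_top _
  sort_bot := by
    intro d
    by_contra hne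
    have := L.eq_bot_of_isa_pos (unitInterval.pos_iff_ne_zero.2 hne)
    obtain ⟨X, _ | ⟨f, l⟩⟩ := d
    · exact h.nodeSort_ne_bot X this
    · exact h.top_ne_bot this
  sort_isa s s' _ := L.isa_trans _ s s'
  sort_glb s s' d hd :=
    (L.glb_spec s s').2.2.2 _ (Set.mem_univ _) (lt_inf_iff.1 hd).1 (lt_inf_iff.1 hd).2

theorem canonicalFeat_eq {t : OSFTerm S F V} (h : t.Normal L) {X Y : V} {f : F}
    (hk : feat X f Y ∈ constraints t) : canonicalFeat t f (X, []) = (Y, []) := by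
  have hex : ∃ Y, feat X f Y ∈ constraints t := ⟨Y, hk⟩
  rw [canonicalFeat, dif_pos hex, h.feat_unique hex.choose_spec hk]

theorem sat_canonical (t : OSFTerm S F V) (h : t.Normal L) :
    Sat (canonical t h) (fun X => (X, [])) (constraints t) := by
  intro k hk
  cases k with
  | sort X s =>
    change 0 < L.isa (nodeSort L t X) s
    rcases h.sort_eq hk with rfl | rfl
    · rw [L.isa_top]; exact zero_lt_one
    · rw [L.isa_refl]; exact zero_lt_one
  | eq X Y => exact absurd hk (eq_notMem_constraints t X Y)
  | feat X f Y => exact degree_feat_pos.2 (canonicalFeat_eq h hk)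

/-- The extension of an assignment of the tags to the canonical interpretation. -/
def canonicalLift (I : Interpretation L F) (α : V → I.Dom) (d : V × List F) : I.Dom :=
  -- The most recent feature is the head of the list, so `foldr` applies it last.
  d.2.foldr I.feat (α d.1)

theorem canonicalLift_feat {I : Interpretation L F} {α : V → I.Dom} {t : OSFTerm S F V}
    (hα : Sat I α (constraints t)) (f : F) (d : V × List F) :
    canonicalLift I α (canonicalFeat t f d) = I.feat f (canonicalLift I α d) := by
  obtain ⟨X, _ | ⟨g, l⟩⟩ := d
  · rw [canonicalFeat]
    split_ifs with h
    · exact (degree_feat_pos.1 (hα _ h.choose_spec)).symm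
    · rfl
  · rfl

theorem le_sort_canonicalLift {I : Interpretation L F} {α : V → I.Dom} {t : OSFTerm S F V}
    {v : unitInterval} (hα : ∀ k ∈ constraints t, v ≤ degree I α k) (d : V × List F) :
    v ≤ I.sort (canonicalSort L t d) (canonicalLift I α d) := by
  obtain ⟨X, _ | ⟨g, l⟩⟩ := d
  · rcases nodeSort_eq_top_or L t X with e | e
    · rw [canonicalSort, e, I.sort_top]; exact unitInterval.le_one'
    · exact hα _ e
  · rw [canonicalSort, I.sort_top]; exact unitInterval.le_one'

/-- The denotation of `t₂` in the canonical interpretation of `t₁` is a lower bound for the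
subsumption degree. -/
theorem denotation_inf_le {t₁ : OSFTerm S F V} (h₁ : t₁.Normal L) (t₂ : OSFTerm S F V)
    (I : Interpretation L F) (d : I.Dom) :
    denotation I t₁ d ⊓ denotation (canonical t₁ h₁) t₂ (t₁.root, []) ≤ denotation I t₂ d := by
  refine le_of_forall_lt fun v hv => ?_
  obtain ⟨hv₁, hv₂⟩ := lt_inf_iff.1 hv
  obtain ⟨α₁, hα₁⟩ := lt_denotation_iff.1 hv₁
  obtain ⟨α₂, hα₂⟩ := lt_denotation_iff.1 hv₂
  -- The suprema need not be attained; a level strictly above `v` is reached by both chosen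
  -- assignments.
  obtain ⟨w, hvw, hw₁, hw₂⟩ : ∃ w, v < w ∧ w ≤ denotationAt I α₁ t₁ d ∧
      w ≤ denotationAt (canonical t₁ h₁) α₂ t₂ (t₁.root, []) :=
    ⟨_, lt_inf_iff.2 ⟨hα₁, hα₂⟩, inf_le_left, inf_le_right⟩
  have hw : 0 < w := (unitInterval.nonneg').trans_lt hvw
  obtain ⟨hd, hk₁⟩ := (le_denotationAt_iff hw _ _).1 hw₁
  obtain ⟨hr, hk₂⟩ := (le_denotationAt_iff hw _ _).1 hw₂
  have hsat : Sat I α₁ (constraints t₁) := fun k hk => hw.trans_le (hk₁ k hk)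
  -- Composing the solution of `t₂` in the canonical interpretation with the map induced by `α₁`
  -- solves `t₂` in `I`.
  refine lt_denotation_iff.2 ⟨fun X => canonicalLift I α₁ (α₂ X), hvw.trans_le ?_⟩
  refine (le_denotationAt_iff hw _ _).2 ⟨?_, fun k hk => ?_⟩
  · rw [← hr]; exact hd
  · have := hk₂ k hk
    cases k with
    | sort X s =>
      exact (le_inf (le_sort_canonicalLift hk₁ (α₂ X)) this).trans (I.sort_isa _ _ _)
    | eq X Y => exact absurd hk (eq_notMem_constraints t₂ X Y)
    | feat X f Y =>
      rw [degree, le_ite_iff hw] at this ⊢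
      rw [← this]
      exact (canonicalLift_feat hsat f (α₂ X)).symm

theorem one_le_denotation_canonical (t : OSFTerm S F V) (h : t.Normal L) :
    denotation (canonical t h) t (t.root, []) = 1 := by
  refine le_antisymm unitInterval.le_one' ?_
  refine le_trans ?_ (le_iSup _ (fun X => (X, [])))
  refine (le_denotationAt_iff zero_lt_one _ _).2 ⟨rfl, fun k hk => ?_⟩
  cases k with
  | sort X s =>
    change 1 ≤ L.isa (nodeSort L t X) s
    rcases h.sort_eq hk with rfl | rfl
    · rw [L.isa_top]
    · rw [L.isa_refl]
  | eq X Y => exact absurd hk (eq_notMem_constraints t X Y)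
  | feat X f Y =>
    rw [degree, if_pos]
    exact canonicalFeat_eq h hk

/-- The canonical interpretation is a universal test: `t₁` has degree 1 at its own root there, and
the value of `t₂` at this point is an admissible degree in all interpretations. -/
theorem subsumption_pos_iff {t₁ : OSFTerm S F V} (h₁ : t₁.Normal L) {t₂ : OSFTerm S F V} :
    0 < subsumption L t₁ t₂ ↔ ∃ α : V → (canonical t₁ h₁).Dom,
      α t₂.root = (t₁.root, []) ∧ Sat (canonical t₁ h₁) α (constraints t₂) := by
  have key : 0 < subsumption L t₁ t₂ ↔ 0 < denotation (canonical t₁ h₁) t₂ (t₁.root, []) := by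
    constructor
    · intro h
      obtain ⟨β, hβ, h0⟩ := lt_sSup_iff.1 h
      have := hβ (canonical t₁ h₁) (t₁.root, [])
      rw [one_le_denotation_canonical] at this
      exact (lt_inf_iff.2 ⟨zero_lt_one, h0⟩).trans_le this
    · exact fun h => h.trans_le (le_sSup fun I d => denotation_inf_le h₁ t₂ I d)
  rw [key, denotation_pos_iff]
  simp only [eq_comm]

theorem denotation_leaf_bot (I : Interpretation L F) (X : V) (d : I.Dom) :
    denotation I (leaf X L.bot) d = 0 := by
  by_contra hne
  obtain ⟨α, -, h⟩ := denotation_pos_iff.1 (unitInterval.pos_iff_ne_zero.2 hne)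
  have := h (sort X L.bot) (by simp [leaf, constraints])
  rw [degree, I.sort_bot] at this
  exact this.false

theorem subsumption_leaf_bot (X : V) (t : OSFTerm S F V) :
    0 < subsumption L (leaf X L.bot) t := by
  refine zero_lt_one.trans_le (le_sSup fun I d => ?_)
  rw [denotation_leaf_bot]
  exact inf_le_left.trans unitInterval.nonneg'

theorem not_subsumption_leaf_bot {t : OSFTerm S F V} (h : t.Normal L) (X : V) :
    ¬ 0 < subsumption L t (leaf X L.bot) := by
  intro hpos
  obtain ⟨α, -, hα⟩ := (subsumption_pos_iff h).1 hpos
  have := hα (sort X L.bot) (by simp [leaf, constraints])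
  rw [degree, Interpretation.sort_bot] at this
  exact this.false

/-- Mutual positive subsumption of normal terms forces full subsumption. -/
theorem denotation_le_of_subsumption_pos {t₁ t₂ : OSFTerm S F V} (h₁ : t₁.Normal L)
    (h₂ : t₂.Normal L) (h₁₂ : 0 < subsumption L t₁ t₂) (h₂₁ : 0 < subsumption L t₂ t₁)
    (I : Interpretation L F) (d : I.Dom) : denotation I t₁ d ≤ denotation I t₂ d := by
  obtain ⟨α₂, hr₂, hs₂⟩ := (subsumption_pos_iff h₁).1 h₁₂
  obtain ⟨α₁, hr₁, hs₁⟩ := (subsumption_pos_iff h₂).1 h₂₁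
  -- Features are functions and all tags of `t₂` are reached from its root, so the round trip
  -- through `t₁` fixes every tag of `t₂`.
  have hback : ∀ X ∈ tags t₂, canonicalLift (canonical t₂ h₂) α₁ (α₂ X) = (X, []) := by
    refine tags_induction t₂ _ ?_ fun X f Y hk hX => ?_
    · rw [hr₂]; exact hr₁
    · have h1 : canonicalFeat t₁ f (α₂ X) = α₂ Y := degree_feat_pos.1 (hs₂ _ hk)
      rw [← h1, canonicalLift_feat hs₁, hX]
      exact canonicalFeat_eq h₂ hk
  -- Sorts can only become more specific along the induced map.
  have hsort : ∀ e : V × List F, 0 < L.isa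
      (canonicalSort L t₂ (canonicalLift (canonical t₂ h₂) α₁ e)) (canonicalSort L t₁ e) := by
    rintro ⟨X, _ | ⟨g, l⟩⟩
    · rcases nodeSort_eq_top_or L t₁ X with e | e
      · rw [canonicalSort.eq_1 L t₁, e, L.isa_top]; exact zero_lt_one
      · exact hs₁ _ e
    · rw [canonicalSort.eq_2 L t₁, L.isa_top]; exact zero_lt_one
  have hone : 1 ≤ denotation (canonical t₁ h₁) t₂ (t₁.root, []) := by
    refine le_trans ?_ (le_iSup _ α₂)
    refine (le_denotationAt_iff zero_lt_one _ _).2 ⟨hr₂.symm, fun k hk => ?_⟩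
    cases k with
    | sort X s =>
      change 1 ≤ L.isa (canonicalSort L t₁ (α₂ X)) s
      have hpos : 0 < L.isa (canonicalSort L t₁ (α₂ X)) s := hs₂ _ hk
      rcases h₂.sort_eq hk with rfl | rfl
      · rw [L.isa_top]
      · have h' := hsort (α₂ X)
        rw [hback X (tags_subset_of_mem_constraints hk rfl)] at h'
        -- After the round trip the two sorts lie positively below each other, so they coincide and
        -- the degree is 1.
        rw [L.isa_antisymm _ _ hpos h', L.isa_refl]
    | eq X Y => exact absurd hk (eq_notMem_constraints t₂ X Y)
    | feat X f Y =>
      rw [degree, if_pos]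
      exact degree_feat_pos.1 (hs₂ _ hk)
  exact (le_inf le_rfl (unitInterval.le_one'.trans hone)).trans (denotation_inf_le h₁ t₂ I d)

theorem equivalent_of_subsumption_pos {t₁ t₂ : OSFTerm S F V} (m₁ : t₁ ∈ latticeTerms L)
    (m₂ : t₂ ∈ latticeTerms L) (h₁₂ : 0 < subsumption L t₁ t₂) (h₂₁ : 0 < subsumption L t₂ t₁) :
    Equivalent L t₁ t₂ := by
  intro I d
  rcases m₁ with h₁ | ⟨X, rfl⟩ <;> rcases m₂ with h₂ | ⟨Y, rfl⟩
  · exact le_antisymm (denotation_le_of_subsumption_pos h₁ h₂ h₁₂ h₂₁ I d)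
      (denotation_le_of_subsumption_pos h₂ h₁ h₂₁ h₁₂ I d)
  · exact absurd h₁₂ (not_subsumption_leaf_bot h₁ Y)
  · exact absurd h₂₁ (not_subsumption_leaf_bot h₂ X)
  · rw [denotation_leaf_bot, denotation_leaf_bot]

/-- A greatest lower bound in the fuzzy term lattice is unique up to equivalence. -/
theorem isUnifier_of_isFuzzyGLB {ψ₁ ψ₂ t : OSFTerm S F V}
    (h : IsFuzzyGLB (subsumption L) (latticeTerms L) ψ₁ ψ₂ t) : IsUnifier L ψ₁ ψ₂ t :=
  ⟨h, fun t' h' => equivalent_of_subsumption_pos h'.1 h.1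
    (h.2.2.2 t' h'.1 h'.2.1 h'.2.2.1) (h'.2.2.2 t h.1 h.2.1 h.2.2.1)⟩

end OSFTerm

end FuzzyOSF

/-! ### Invariants of the normalization rules. -/

namespace FuzzyOSF

namespace OSFConstraint

variable {S F V : Type u}

theorem tags_rename (k : OSFConstraint S F V) (ρ : V → V) : (k.rename ρ).tags = ρ '' k.tags := by
  cases k <;> simp [rename, tags, Set.image_pair]

theorem finite_tags (k : OSFConstraint S F V) : k.tags.Finite := by
  cases k <;> simp [tags]

theorem isEq_rename (k : OSFConstraint S F V) (ρ : V → V) : (k.rename ρ).IsEq ↔ k.IsEq := by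
  cases k <;> simp [rename, IsEq]

variable {L : FuzzyLattice S}

theorem degree_rename (I : Interpretation L F) (α : V → I.Dom) (ρ : V → V)
    (k : OSFConstraint S F V) : degree I α (k.rename ρ) = degree I (α ∘ ρ) k := by
  cases k <;> rfl

end OSFConstraint

namespace OSFClause

variable {S F V : Type u} {L : FuzzyLattice S}

open OSFConstraint

theorem tags_add (c c' : OSFClause S F V) : tags (c + c') = tags c ∪ tags c' := by
  ext X; simp [tags, or_and_right, exists_or]

theorem tags_singleton (k : OSFConstraint S F V) : tags {k} = k.tags := by
  ext X; simp [tags]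

theorem finite_tags (c : OSFClause S F V) : c.tags.Finite := by
  classical
  have : c.tags = ⋃ k ∈ c.toFinset, k.tags := by ext X; simp [tags]
  rw [this]
  exact Set.Finite.biUnion c.toFinset.finite_toSet fun k _ => k.finite_tags

open Classical in
theorem tags_subst (c : OSFClause S F V) (X Y : V) :
    tags (c.subst X Y) = Function.update id Y X '' tags c := by
  ext Z
  simp only [tags, subst, Multiset.mem_map, Set.mem_ofPred_eq, Set.mem_image]
  constructor
  · rintro ⟨_, ⟨k, hk, rfl⟩, hZ⟩
    rw [tags_rename] at hZ
    obtain ⟨W, hW, rfl⟩ := hZ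
    exact ⟨W, ⟨k, hk, hW⟩, rfl⟩
  · rintro ⟨W, ⟨k, hk, hW⟩, rfl⟩
    exact ⟨_, ⟨k, hk, rfl⟩, by rw [tags_rename]; exact ⟨W, hW, rfl⟩⟩

theorem mem_tags_subst {c : OSFClause S F V} {X Y Z : V} (h : Z ∈ tags (c.subst X Y)) :
    Z = X ∨ Z ∈ tags c ∧ Z ≠ Y := by
  classical
  rw [tags_subst] at h
  obtain ⟨W, hW, rfl⟩ := h
  by_cases e : W = Y
  · subst e; left; simp
  · right; rw [Function.update_of_ne e]; exact ⟨hW, e⟩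

theorem tags_subst_subset (c : OSFClause S F V) (X Y : V) :
    tags (c.subst X Y + {eq X Y}) ⊆ tags (c + {eq X Y}) := by
  simp only [tags_add, tags_singleton]
  refine Set.union_subset (fun Z hZ => ?_) Set.subset_union_right
  rcases mem_tags_subst hZ with rfl | ⟨h, -⟩
  · exact Or.inr (Or.inl rfl)
  · exact Or.inl h

theorem subst_self (c : OSFClause S F V) (X : V) : c.subst X X = c := by
  classical
  rw [subst]
  conv_rhs => rw [← Multiset.map_id c]
  refine Multiset.map_congr rfl fun k _ => ?_
  have : Function.update id X X = (id : V → V) := Function.update_eq_self X id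
  rw [this]
  cases k <;> rfl

theorem sat_subst {I : Interpretation L F} {α : V → I.Dom} {c : OSFClause S F V} {X Y : V}
    (h : α X = α Y) : Sat I α (c.subst X Y) ↔ Sat I α c := by
  classical
  have hα : α ∘ Function.update id Y X = α := by
    funext Z
    by_cases e : Z = Y
    · subst e; simp [h]
    · simp [Function.update_of_ne e]
  simp [Sat, subst, degree_rename, hα]

/-- Normalization rules preserve positive satisfiability. -/
theorem Rule.sat_iff {c c' : OSFClause S F V} (h : Rule L c c') (I : Interpretation L F)
    (α : V → I.Dom) : Sat I α c ↔ Sat I α c' := by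
  cases h with
  | sortIntersection c X s s' =>
    simp only [sat_add, sat_singleton, and_assoc]
    refine and_congr_right fun _ => ?_
    constructor
    · rintro ⟨h1, h2⟩
      exact I.sort_glb s s' _ (lt_inf_iff.2 ⟨h1, h2⟩)
    · intro h
      have hg := L.glb_spec s s'
      exact ⟨(lt_inf_iff.2 ⟨h, hg.2.1⟩).trans_le (I.sort_isa _ _ _),
        (lt_inf_iff.2 ⟨h, hg.2.2.1⟩).trans_le (I.sort_isa _ _ _)⟩
  | featureFunctionality c X f Y Y' =>
    simp only [sat_add, sat_singleton, and_assoc, degree_feat_pos, degree_eq_pos]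
    refine and_congr_right fun _ => and_congr_right fun h => ?_
    rw [h]
  | inconsistentSort c X =>
    simp only [sat_add, sat_singleton]
    -- `X : ⊥` has no positive solution, so discarding the rest of the clause loses nothing.
    refine ⟨fun h => h.2, fun h => ?_⟩
    rw [degree, I.sort_bot] at h
    exact absurd h (lt_irrefl _)
  | tagElimination c X Y hY =>
    simp only [sat_add, sat_singleton, degree_eq_pos]
    exact and_congr_left fun h => (sat_subst h).symm

theorem sat_iff_of_steps {c c' : OSFClause S F V} (h : Relation.ReflTransGen (Step L) c c')
    (I : Interpretation L F) (α : V → I.Dom) : Sat I α c ↔ Sat I α c' := by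
  induction h with
  | refl => rfl
  | tail _ h ih => exact ih.trans (h.1.sat_iff I α)

theorem Rule.tags_subset {c c' : OSFClause S F V} (h : Rule L c c') : tags c' ⊆ tags c := by
  cases h with
  | sortIntersection c X s s' =>
    simp only [tags_add, tags_singleton, OSFConstraint.tags]
    intro Z; simp
  | featureFunctionality c X f Y Y' =>
    simp only [tags_add, tags_singleton, OSFConstraint.tags]
    intro Z; simp
  | inconsistentSort c X =>
    simp only [tags_add, tags_singleton]
    exact Set.subset_union_right
  | tagElimination c X Y hY => exact tags_subst_subset c X Y

theorem tags_subset_of_steps {c c' : OSFClause S F V} (h : Relation.ReflTransGen (Step L) c c') :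
    tags c' ⊆ tags c := by
  induction h with
  | refl => rfl
  | tail _ h ih => exact h.1.tags_subset.trans ih

/-- The set of tags is closed under the feature constraints and the equality constraints of the
clause. -/
def Closed (c : OSFClause S F V) (U : Set V) : Prop :=
  ∀ k ∈ c, match k with
    | .sort _ _ => True
    | .eq X Y => X ∈ U ↔ Y ∈ U
    | .feat X _ Y => X ∈ U → Y ∈ U

/-- The set of tags contains the tags with a sort and is closed under the equality constraints of
the clause. -/
def Sorted (c : OSFClause S F V) (U : Set V) : Prop :=
  ∀ k ∈ c, match k with
    | .sort X _ => X ∈ U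
    | .eq X Y => X ∈ U ↔ Y ∈ U
    | .feat _ _ _ => True

theorem mem_update_iff [DecidableEq V] {U : Set V} {X Y : V} (h : X ∈ U ↔ Y ∈ U) (Z : V) :
    Function.update id Y X Z ∈ U ↔ Z ∈ U := by
  by_cases e : Z = Y
  · subst e; simpa using h
  · simp [Function.update_of_ne e]

/-- Closed sets pull back to the premise: a lost `X.f ≐ Y'` follows from `X.f ≐ Y` and `Y ≐ Y'`, and
renaming is harmless as `U` does not separate `X` from `Y`. This carries reachability from the root
over to normal forms. -/
theorem Rule.closed {c c' : OSFClause S F V} (h : Rule L c c') (hc : ¬ Inconsistent L c')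
    {U : Set V} (hU : Closed c' U) : Closed c U := by
  classical
  cases h with
  | sortIntersection c X s s' =>
    intro k hk
    simp only [Multiset.mem_add, Multiset.mem_singleton] at hk
    rcases hk with (hk | rfl) | rfl
    · exact hU k (Multiset.mem_add.2 (Or.inl hk))
    · trivial
    · trivial
  | featureFunctionality c X f Y Y' =>
    intro k hk
    rcases Multiset.mem_add.1 hk with hk | hk
    · exact hU k (Multiset.mem_add.2 (Or.inl hk))
    · rw [Multiset.mem_singleton.1 hk]
      have h1 : X ∈ U → Y ∈ U := hU (feat X f Y) (by simp)
      have h2 : Y ∈ U ↔ Y' ∈ U := hU (eq Y Y') (by simp)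
      exact fun hX => h2.1 (h1 hX)
  | inconsistentSort c X => exact absurd ⟨X, rfl⟩ hc
  | tagElimination c X Y hY =>
    have h2 : X ∈ U ↔ Y ∈ U := hU (eq X Y) (by simp)
    intro k hk
    rcases Multiset.mem_add.1 hk with hk | hk
    · have h3 := hU (k.rename (Function.update id Y X))
        (Multiset.mem_add.2 (Or.inl (Multiset.mem_map_of_mem _ hk)))
      cases k with
      | sort Z s => trivial
      | eq Z W => simpa only [rename, mem_update_iff h2] using h3
      | feat Z f W => simpa only [rename, mem_update_iff h2] using h3
    · rw [Multiset.mem_singleton.1 hk]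
      exact h2

/-- Intersection keeps a sort on its tag, and `U` does not separate identified tags. This is used to
show that every tag of a normal form still has a sort. -/
theorem Rule.sorted {c c' : OSFClause S F V} (h : Rule L c c') (hc : ¬ Inconsistent L c')
    {U : Set V} (hU : Sorted c' U) : Sorted c U := by
  classical
  cases h with
  | sortIntersection c X s s' =>
    have h1 : X ∈ U := hU (sort X (L.glb s s')) (by simp)
    intro k hk
    simp only [Multiset.mem_add, Multiset.mem_singleton] at hk
    rcases hk with (hk | rfl) | rfl
    · exact hU k (Multiset.mem_add.2 (Or.inl hk))
    · exact h1
    · exact h1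
  | featureFunctionality c X f Y Y' =>
    intro k hk
    rcases Multiset.mem_add.1 hk with hk | hk
    · exact hU k (Multiset.mem_add.2 (Or.inl hk))
    · rw [Multiset.mem_singleton.1 hk]
      trivial
  | inconsistentSort c X => exact absurd ⟨X, rfl⟩ hc
  | tagElimination c X Y hY =>
    have h2 : X ∈ U ↔ Y ∈ U := hU (eq X Y) (by simp)
    intro k hk
    rcases Multiset.mem_add.1 hk with hk | hk
    · have h3 := hU (k.rename (Function.update id Y X))
        (Multiset.mem_add.2 (Or.inl (Multiset.mem_map_of_mem _ hk)))
      cases k with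
      | sort Z s => simpa only [rename, mem_update_iff h2] using h3
      | eq Z W => simpa only [rename, mem_update_iff h2] using h3
      | feat Z f W => trivial
    · rw [Multiset.mem_singleton.1 hk]
      exact h2

/-- Consequently every clause on the way to a consistent result is consistent, as the pullback
lemmas require. -/
theorem not_step_of_inconsistent {c c' : OSFClause S F V} (hc : Inconsistent L c) :
    ¬ Step L c c' := by
  obtain ⟨X, rfl⟩ := hc
  rintro ⟨h, hne⟩
  generalize hd : ({sort X L.bot} : OSFClause S F V) = d at h
  have hcard := congrArg Multiset.card hd
  cases h with
  | sortIntersection c Y s s' => simp at hcard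
  | featureFunctionality c Y f Z Z' => simp at hcard
  | inconsistentSort c Y =>
    have : c = 0 := by
      rw [← Multiset.card_eq_zero]
      simpa using hcard
    subst this
    exact hne (by rw [hd, zero_add])
  | tagElimination c Y Z hZ =>
    have : c = 0 := by
      rw [← Multiset.card_eq_zero]
      simpa using hcard
    subst this
    obtain ⟨k, hk, -⟩ := hZ
    exact Multiset.notMem_zero k hk

theorem closed_of_steps {c c' : OSFClause S F V} (h : Relation.ReflTransGen (Step L) c c')
    (hc : ¬ Inconsistent L c') {U : Set V} (hU : Closed c' U) : Closed c U := by
  induction h using Relation.ReflTransGen.head_induction_on with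
  | refl => exact hU
  | head h h' ih =>
    refine h.1.closed (fun hi => ?_) ih
    rcases h'.cases_head with rfl | ⟨_, h'', -⟩
    · exact hc hi
    · exact not_step_of_inconsistent hi h''

theorem sorted_of_steps {c c' : OSFClause S F V} (h : Relation.ReflTransGen (Step L) c c')
    (hc : ¬ Inconsistent L c') {U : Set V} (hU : Sorted c' U) : Sorted c U := by
  induction h using Relation.ReflTransGen.head_induction_on with
  | refl => exact hU
  | head h h' ih =>
    refine h.1.sorted (fun hi => ?_) ih
    rcases h'.cases_head with rfl | ⟨_, h'', -⟩
    · exact hc hi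
    · exact not_step_of_inconsistent hi h''

/-! ### Termination -/

/-- The tag `Y` occurs in the clause only once, as the right-hand side of an equality. -/
def Isolated (c : OSFClause S F V) (Y : V) : Prop :=
  ∃ X c', c = c' + {eq X Y} ∧ Y ∉ tags c' ∧ X ≠ Y

/-- The number of tags that have not been eliminated. -/
noncomputable def activeCard (c : OSFClause S F V) : ℕ := {Y ∈ tags c | ¬ Isolated c Y}.ncard

/-- The tag `Y` becomes isolated and was not so before, while isolated tags remain isolated and no
new tags appear. -/
theorem activeCard_lt {c : OSFClause S F V} {X Y : V} (hY : Y ∈ tags c) (hne : X ≠ Y) :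
    activeCard (c.subst X Y + {eq X Y}) < activeCard (c + {eq X Y}) := by
  classical
  have hnew : Isolated (c.subst X Y + {eq X Y}) Y := by
    refine ⟨X, _, rfl, fun h => ?_, hne⟩
    rcases mem_tags_subst h with h | h
    · exact hne h.symm
    · exact h.2 rfl
  have hold : ¬ Isolated (c + {eq X Y}) Y := by
    rintro ⟨W, c', e, hc', -⟩
    have hmem : eq X Y ∈ c' + {eq W Y} := by rw [← e]; simp
    rcases Multiset.mem_add.1 hmem with h | h
    · exact hc' ⟨_, h, Or.inr rfl⟩
    · rw [Multiset.mem_singleton.1 h, add_left_inj] at e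
      exact hc' (e ▸ hY)
  have hsub := tags_subst_subset c X Y
  refine Set.ncard_lt_ncard ?_ ((finite_tags _).subset fun Z hZ => hZ.1)
  refine ⟨fun Z hZ => ⟨hsub hZ.1, ?_⟩, fun h => (h ⟨?_, hold⟩).2 hnew⟩
  · rintro ⟨W, c', e, hc', hWZ⟩
    have hZY : Z ≠ Y := by rintro rfl; exact hZ.2 hnew
    have hmem : eq X Y ∈ c' + {eq W Z} := by rw [← e]; simp
    rcases Multiset.mem_add.1 hmem with h | h
    · obtain ⟨c'', rfl⟩ := Multiset.exists_cons_of_mem h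
      have e' : c = c'' + {eq W Z} := by
        rw [← add_left_inj ({eq X Y} : OSFClause S F V), e, ← Multiset.singleton_add,
          add_assoc, add_comm]
      have hZX : Z ≠ X := by
        rintro rfl
        exact hc' ⟨_, Multiset.mem_cons_self _ _, Or.inl rfl⟩
      -- Only the left-hand tag of the equality isolating `Z` can be renamed; `Z` itself is neither
      -- `X` nor `Y`.
      refine hZ.2 ⟨Function.update id Y X W, subst c'' X Y + {eq X Y}, ?_, ?_, ?_⟩
      · rw [e', subst, Multiset.map_add, Multiset.map_singleton, rename,
          Function.update_of_ne hZY, add_right_comm]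
        rfl
      · rw [tags_add, tags_singleton]
        rintro (h | h | h)
        · rcases mem_tags_subst h with h | ⟨⟨k, hk, hk'⟩, -⟩
          · exact hZX h
          · exact hc' ⟨k, Multiset.mem_cons_of_mem hk, hk'⟩
        · exact hZX h
        · exact hZY h
      · by_cases eW : W = Y
        · subst eW; simpa using hZX.symm
        · rw [Function.update_of_ne eW]; exact hWZ
    · cases Multiset.mem_singleton.1 h
      exact hZY rfl
  · rw [tags_add]; exact Or.inl hY

theorem solved_add (c c' : OSFClause S F V) : solved (c + c') = solved c + solved c' := by
  classical
  exact Multiset.filter_add _ _ _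

theorem card_solved_subst (c : OSFClause S F V) (X Y : V) :
    (solved (c.subst X Y)).card = (solved c).card := by
  classical
  rw [solved, solved, subst, Multiset.filter_map, Multiset.card_map]
  simp only [Function.comp_def, isEq_rename]

/-- The termination measure of the normalization rules. -/
noncomputable def measure (c : OSFClause S F V) : ℕ ×ₗ (ℕ ×ₗ ℕ) :=
  toLex ((solved c).card, toLex (c.card, activeCard c))

/-- Sort intersection and feature functionality remove a non-equality constraint. The rule for `⊥`
lowers this number, or the total number if only equalities are discarded. Tag elimination keeps both
and lowers the number of active tags. -/
theorem Step.measure_lt {c c' : OSFClause S F V} (h : Step L c c') : measure c' < measure c := by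
  classical
  obtain ⟨h, hne⟩ := h
  have hsort : ∀ X s, solved ({sort X s} : OSFClause S F V) = {sort X s} := fun X s => by
    rw [solved, Multiset.filter_eq_self]
    intro k hk; cases Multiset.mem_singleton.1 hk; exact id
  have hfeat : ∀ X f Y, solved ({feat X f Y} : OSFClause S F V) = {feat X f Y} := fun X f Y => by
    rw [solved, Multiset.filter_eq_self]
    intro k hk; cases Multiset.mem_singleton.1 hk; exact id
  have heq : ∀ X Y, solved ({eq X Y} : OSFClause S F V) = 0 := fun X Y => by
    rw [solved, Multiset.filter_eq_nil]
    intro k hk; cases Multiset.mem_singleton.1 hk; exact fun h => h trivial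
  unfold measure
  cases h with
  | sortIntersection c X s s' =>
    rw [Prod.Lex.toLex_lt_toLex]
    left
    simp [solved_add, hsort]
  | featureFunctionality c X f Y Y' =>
    rw [Prod.Lex.toLex_lt_toLex]
    left
    simp [solved_add, hfeat, heq]
  | inconsistentSort c X =>
    have hc : c ≠ 0 := by rintro rfl; exact hne (by rw [zero_add])
    have hc' : 0 < c.card := Multiset.card_pos.2 hc
    rw [Prod.Lex.toLex_lt_toLex, Prod.Lex.toLex_lt_toLex]
    simp only [solved_add, hsort, Multiset.card_add, Multiset.card_singleton]
    omega
  | tagElimination c X Y hY =>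
    have hXY : X ≠ Y := by rintro rfl; exact hne (by rw [subst_self])
    rw [Prod.Lex.toLex_lt_toLex, Prod.Lex.toLex_lt_toLex]
    refine Or.inr ⟨?_, Or.inr ⟨?_, activeCard_lt hY hXY⟩⟩
    · simp [solved_add, card_solved_subst]
    · simp [subst]

theorem terminates (c : OSFClause S F V) : c.Terminates L := by
  rintro ⟨σ, -, h⟩
  have hwf : WellFounded ((· < ·) : ℕ ×ₗ (ℕ ×ₗ ℕ) → _ → Prop) := wellFounded_lt
  exact (wellFounded_iff_isEmpty_descending_chain.1 hwf).false
    ⟨fun n => measure (σ n), fun n => (h n).measure_lt⟩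

end OSFClause

end FuzzyOSF

/-! ### Unfolding a finite feature graph into a normal term. -/

namespace FuzzyOSF

namespace OSFTerm

variable {S F V : Type u} {L : FuzzyLattice S}

open OSFConstraint OSFClause

open Classical in
/-- The roots of the subterms that are different from a sorted variable of sort `⊤`. -/
noncomputable def expanded (L : FuzzyLattice S) (t : OSFTerm S F V) : Multiset V :=
  ((subterms t).filter (fun r => r ≠ leaf r.root L.top)).map root

theorem normal_mk {X : V} {s : S} {n : ℕ} {f : Fin n → F} {t : Fin n → OSFTerm S F V}
    (hs : s ≠ L.bot) (hf : Function.Injective f) (ht : ∀ i, (t i).Normal L)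
    (he : (expanded L (mk X s n f t)).Nodup) : (mk X s n f t).Normal L := by
  classical
  rw [Normal]
  refine ⟨hs, hf, ht, fun Y => ?_⟩
  have := Multiset.nodup_iff_count_le_one.1 he Y
  rw [expanded, Multiset.count_map, Multiset.filter_filter] at this
  refine (congrArg Multiset.card (Multiset.filter_congr fun r _ => ?_)).trans_le this
  constructor
  · rintro ⟨rfl, h⟩; exact ⟨rfl, h⟩
  · rintro ⟨rfl, h⟩; exact ⟨rfl, h⟩

/-- Equality fails when the term is itself `X : ⊤` without features, as its root is then not
counted. -/
theorem expanded_mk_le (X : V) (s : S) (n : ℕ) (f : Fin n → F) (t : Fin n → OSFTerm S F V) :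
    expanded L (mk X s n f t) ≤ X ::ₘ ∑ i, expanded L (t i) := by
  classical
  have hsum : ∀ T : Finset (Fin n), (((∑ i ∈ T, subterms (t i)).filter
      (fun r => r ≠ leaf r.root L.top)).map root) = ∑ i ∈ T, expanded L (t i) := by
    intro T
    induction T using Finset.induction with
    | empty => rfl
    | insert a T ha ih =>
      rw [Finset.sum_insert ha, Finset.sum_insert ha, Multiset.filter_add, Multiset.map_add, ih]
      rfl
  rw [← hsum, expanded, subterms, Multiset.filter_cons]
  split_ifs
  · rw [Multiset.singleton_add, Multiset.map_cons]; rfl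
  · rw [zero_add]; exact Multiset.le_cons_self _ _

theorem expanded_leaf_top (Y : V) : expanded L (leaf Y L.top : OSFTerm S F V) = 0 := by
  classical
  have h : subterms (leaf Y L.top : OSFTerm S F V) = {leaf Y L.top} := by
    simp [leaf, subterms]
  rw [expanded, h, Multiset.filter_eq_nil.2]
  · rfl
  · intro r hr
    rw [Multiset.mem_singleton.1 hr]
    exact fun h => h rfl

/-- A labelled graph on the tags, in which the nodes carry sorts and the edges carry features. -/
structure FeatureGraph (S F V : Type u) where
  sort : V → S
  deg : V → ℕ
  lab : ∀ X, Fin (deg X) → F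
  tgt : ∀ X, Fin (deg X) → V

/-- The constraints `c` of terms whose expanded tags are `e` describe the part `B` of a graph,
where `B` is closed under the edges within the set `A` of the tags that may be expanded. -/
structure FeatureGraph.Spans (G : FeatureGraph S F V) (L : FuzzyLattice S) (A B : Finset V)
    (c : OSFClause S F V) (e : Multiset V) : Prop where
  subset : B ⊆ A
  expanded_le : e ≤ B.val
  sort_eq : ∀ Y s, .sort Y s ∈ c → s = G.sort Y ∨ s = L.top
  sort_mem : ∀ Y ∈ B, .sort Y (G.sort Y) ∈ c
  feat_iff : ∀ Y f Z, .feat Y f Z ∈ c ↔ Y ∈ B ∧ ∃ i, G.lab Y i = f ∧ G.tgt Y i = Z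
  closed : ∀ Y ∈ B, ∀ i, G.tgt Y i ∈ B ∨ G.tgt Y i ∉ A

variable {G : FeatureGraph S F V}

/-- Traversals compose: the second may expand only what the first left over, so nothing is expanded
twice, and its edges into `B` end inside the union. -/
theorem FeatureGraph.Spans.union [DecidableEq V] {A B B' : Finset V} {c c' : OSFClause S F V} {e e' : Multiset V}
    (h : G.Spans L A B c e) (h' : G.Spans L (A \ B) B' c' e') :
    G.Spans L A (B ∪ B') (c + c') (e + e') where
  subset := Finset.union_subset h.subset (h'.subset.trans Finset.sdiff_subset)
  expanded_le := by
    have hd : Disjoint B B' := Finset.disjoint_of_subset_right h'.subset Finset.disjoint_sdiff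
    rw [← Finset.disjUnion_eq_union B B' hd]
    exact add_le_add h.expanded_le h'.expanded_le
  sort_eq Y s hk := (Multiset.mem_add.1 hk).elim (h.sort_eq Y s) (h'.sort_eq Y s)
  sort_mem Y hY := Multiset.mem_add.2 <|
    (Finset.mem_union.1 hY).imp (h.sort_mem Y) (h'.sort_mem Y)
  feat_iff Y f Z := by
    rw [Multiset.mem_add, h.feat_iff, h'.feat_iff, Finset.mem_union, or_and_right]
  closed Y hY i := by
    rcases Finset.mem_union.1 hY with hY | hY
    · rcases h.closed Y hY i with h | h
      · exact Or.inl (Finset.mem_union_left _ h)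
      · exact Or.inr h
    · rcases h'.closed Y hY i with h | h
      · exact Or.inl (Finset.mem_union_right _ h)
      · rw [Finset.mem_sdiff, not_and_not_right] at h
        by_cases hA : G.tgt Y i ∈ A
        · exact Or.inl (Finset.mem_union_left _ (h hA))
        · exact Or.inr hA

theorem FeatureGraph.spans_empty (A : Finset V) (c : OSFClause S F V)
    (hc : ∀ k ∈ c, ∃ Y, k = .sort Y L.top) : G.Spans L A ∅ c 0 where
  subset := Finset.empty_subset _
  expanded_le := le_rfl
  sort_eq Y s hk := by
    obtain ⟨_, h⟩ := hc _ hk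
    cases h
    exact Or.inr rfl
  sort_mem Y hY := absurd hY (Finset.notMem_empty _)
  feat_iff Y f Z := by
    refine ⟨fun hk => ?_, fun h => absurd h.1 (Finset.notMem_empty _)⟩
    obtain ⟨_, h⟩ := hc _ hk
    cases h
  closed Y hY := absurd hY (Finset.notMem_empty _)

theorem FeatureGraph.exists_forest [DecidableEq V] (htop : L.top ≠ L.bot) {k : ℕ}
    (ih : ∀ A : Finset V, A.card ≤ k → ∀ X ∈ A, ∃ (t : OSFTerm S F V) (B : Finset V),
      t.root = X ∧ t.Normal L ∧ X ∈ B ∧ G.Spans L A B (constraints t) (expanded L t))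
    (n : ℕ) (Y : Fin n → V) (A : Finset V) (hA : A.card ≤ k) :
    ∃ (t : Fin n → OSFTerm S F V) (B : Finset V), (∀ i, (t i).root = Y i) ∧
      (∀ i, (t i).Normal L) ∧ (∀ i, Y i ∈ B ∨ Y i ∉ A) ∧
      G.Spans L A B (∑ i, constraints (t i)) (∑ i, expanded L (t i)) := by
  induction n generalizing A with
  | zero =>
    refine ⟨Fin.elim0, ∅, fun i => i.elim0, fun i => i.elim0, fun i => i.elim0, ?_⟩
    simpa using FeatureGraph.spans_empty A 0 (by simp)
  | succ n ihn =>
    obtain ⟨t₀, B₀, hr₀, hn₀, hB₀, hs₀⟩ : ∃ (t : OSFTerm S F V) (B : Finset V), t.root = Y 0 ∧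
        t.Normal L ∧ (Y 0 ∈ B ∨ Y 0 ∉ A) ∧ G.Spans L A B (constraints t) (expanded L t) := by
      by_cases h : Y 0 ∈ A
      · obtain ⟨t, B, h1, h2, h3, h4⟩ := ih A hA (Y 0) h
        exact ⟨t, B, h1, h2, Or.inl h3, h4⟩
      -- A tag that may no longer be expanded is represented by `Y : ⊤`, which adds nothing to the
      -- graph.
      · refine ⟨leaf (Y 0) L.top, ∅, rfl, ?_, Or.inr h, ?_⟩
        · refine normal_mk htop (fun i => i.elim0) (fun i => i.elim0) ?_
          have := expanded_leaf_top (L := L) (F := F) (Y 0)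
          rw [leaf] at this
          rw [this]
          exact Multiset.nodup_zero
        · rw [expanded_leaf_top]
          refine FeatureGraph.spans_empty A _ fun k hk => ⟨Y 0, ?_⟩
          simpa [leaf, constraints] using hk
    obtain ⟨t, B, hr, hn, hB, hs⟩ := ihn (fun i => Y i.succ) (A \ B₀)
      ((Finset.card_le_card Finset.sdiff_subset).trans hA)
    refine ⟨Fin.cons t₀ t, B₀ ∪ B, Fin.cases hr₀ hr, Fin.cases hn₀ hn,
      Fin.cases (hB₀.imp_left (Finset.mem_union_left _)) fun i => ?_, ?_⟩
    · rw [Fin.sum_univ_succ, Fin.sum_univ_succ]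
      exact hs₀.union hs
    · rcases hB i with h | h
      · exact Or.inl (Finset.mem_union_right _ h)
      · rw [Finset.mem_sdiff, not_and_not_right] at h
        by_cases hA : Y i.succ ∈ A
        · exact Or.inl (Finset.mem_union_left _ (h hA))
        · exact Or.inr hA

/-- Depth-first search, by induction on the number of tags that may still be expanded. The root
leaves this set before its children are visited, so cycles end in leaves `Y : ⊤`. -/
theorem FeatureGraph.exists_tree [DecidableEq V] (htop : L.top ≠ L.bot) (hsort : ∀ X, G.sort X ≠ L.bot)
    (hlab : ∀ X, Function.Injective (G.lab X)) (k : ℕ) :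
    ∀ A : Finset V, A.card ≤ k → ∀ X ∈ A, ∃ (t : OSFTerm S F V) (B : Finset V),
      t.root = X ∧ t.Normal L ∧ X ∈ B ∧ G.Spans L A B (constraints t) (expanded L t) := by
  induction k with
  | zero =>
    intro A hA X hX
    rw [Finset.card_eq_zero.1 (Nat.le_zero.1 hA)] at hX
    exact absurd hX (Finset.notMem_empty _)
  | succ k ih =>
    intro A hA X hX
    obtain ⟨t, B, hr, hn, hB, hs⟩ := FeatureGraph.exists_forest htop ih (G.deg X) (G.tgt X)
      (A.erase X) (by rw [Finset.card_erase_of_mem hX]; omega)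
    have hXB : X ∉ B := fun h => Finset.notMem_erase X A (hs.subset h)
    have hle : expanded L (OSFTerm.mk X (G.sort X) _ (G.lab X) t) ≤ (insert X B).val := by
      rw [Finset.insert_val_of_notMem hXB]
      exact (expanded_mk_le _ _ _ _ _).trans ((Multiset.cons_le_cons_iff X).2 hs.expanded_le)
    have hmem : ∀ k, k ∈ constraints (OSFTerm.mk X (G.sort X) _ (G.lab X) t) ↔ k = .sort X (G.sort X) ∨
        (∃ i, k = .feat X (G.lab X i) (G.tgt X i)) ∨ k ∈ ∑ i, constraints (t i) := by
      intro k
      simp only [constraints, Multiset.mem_add, Multiset.mem_singleton, Multiset.mem_sum,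
        Finset.mem_univ, true_and, hr, exists_or]
    refine ⟨OSFTerm.mk X (G.sort X) _ (G.lab X) t, insert X B, rfl,
      normal_mk (hsort X) (hlab X) hn (Multiset.nodup_of_le hle (insert X B).nodup),
      Finset.mem_insert_self _ _, ?_, hle, ?_, ?_, ?_, ?_⟩
    · exact Finset.insert_subset hX (hs.subset.trans (Finset.erase_subset _ _))
    · intro Y s hk
      rcases (hmem _).1 hk with h | ⟨i, h⟩ | h
      · cases h; exact Or.inl rfl
      · cases h
      · exact hs.sort_eq Y s h
    · intro Y hY
      rw [hmem]
      rcases Finset.mem_insert.1 hY with rfl | hY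
      · exact Or.inl rfl
      · exact Or.inr (Or.inr (hs.sort_mem Y hY))
    · intro Y f Z
      rw [hmem, hs.feat_iff, Finset.mem_insert]
      constructor
      · rintro (h | ⟨i, h⟩ | ⟨h, h'⟩)
        · cases h
        · cases h; exact ⟨Or.inl rfl, i, rfl, rfl⟩
        · exact ⟨Or.inr h, h'⟩
      · rintro ⟨rfl | h, h'⟩
        · obtain ⟨i, rfl, rfl⟩ := h'
          exact Or.inr (Or.inl ⟨i, rfl⟩)
        · exact Or.inr (Or.inr ⟨h, h'⟩)
    · have key : ∀ Z, Z ∈ B ∨ Z ∉ A.erase X → Z ∈ insert X B ∨ Z ∉ A := by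
        intro Z
        rw [Finset.mem_erase, Finset.mem_insert]
        tauto
      intro Y hY i
      rcases Finset.mem_insert.1 hY with rfl | hY
      · exact key _ (hB i)
      · exact key _ (hs.closed Y hY i)

end OSFTerm

end FuzzyOSF

/-! ### Terms from clauses, and the structure of normal forms. -/

namespace FuzzyOSF

namespace OSFTerm

variable {S F V : Type u} {L : FuzzyLattice S}

open OSFConstraint OSFClause

/-- A clause without equality constraints, in which every tag has exactly one sort and at most one
value for each feature, is the clause of a normal term if all its tags can be reached from the
root. -/
theorem exists_clause_eq (htop : L.top ≠ L.bot) {c : OSFClause S F V} (hnodup : c.Nodup)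
    (heq : ∀ X Y, .eq X Y ∉ c) (hbot : ∀ X, .sort X L.bot ∉ c)
    (huniq : ∀ X s s', .sort X s ∈ c → .sort X s' ∈ c → s = s')
    (hfeat : ∀ X f Y Y', .feat X f Y ∈ c → .feat X f Y' ∈ c → Y = Y')
    (hsort : ∀ X ∈ OSFClause.tags c, ∃ s, .sort X s ∈ c) {r : V} (hr : r ∈ OSFClause.tags c)
    (hreach : ∀ U : Set V, r ∈ U → (∀ X f Y, .feat X f Y ∈ c → X ∈ U → Y ∈ U) → OSFClause.tags c ⊆ U) :
    ∃ ψ : OSFTerm S F V, ψ.Normal L ∧ clause L ψ = c ∧ ψ.root = r := by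
  classical
  have hfin : ∀ X, {p : F × V | feat X p.1 p.2 ∈ c}.Finite := fun X =>
    (c.toFinset.finite_toSet.preimage (f := fun p : F × V => feat X p.1 p.2)
      (fun p _ q _ h => by
        simp only [feat.injEq, true_and] at h
        exact Prod.ext h.1 h.2)).subset fun p hp => by simpa using hp
  -- The default `⊤` keeps the sorts of tags outside the clause different from `⊥`.
  let σ : V → S := fun X => if h : ∃ s, sort X s ∈ c then h.choose else L.top
  have hσ : ∀ X ∈ OSFClause.tags c, sort X (σ X) ∈ c := fun X hX => by
    simp only [σ, dif_pos (hsort X hX)]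
    exact (hsort X hX).choose_spec
  let G : FeatureGraph S F V :=
    { sort := σ
      deg := fun X => (hfin X).toFinset.card
      lab := fun X i => ((hfin X).toFinset.equivFin.symm i).1.1
      tgt := fun X i => ((hfin X).toFinset.equivFin.symm i).1.2 }
  have hedge : ∀ X i, feat X (G.lab X i) (G.tgt X i) ∈ c := fun X i => by
    have := ((hfin X).toFinset.equivFin.symm i).2
    rwa [Set.Finite.mem_toFinset] at this
  have hedge' : ∀ X f Y, feat X f Y ∈ c → ∃ i, G.lab X i = f ∧ G.tgt X i = Y := by
    intro X f Y h
    refine ⟨(hfin X).toFinset.equivFin ⟨(f, Y), (hfin X).mem_toFinset.2 h⟩, ?_, ?_⟩ <;> simp [G]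
  obtain ⟨t, B, hroot, hn, hrB, hs⟩ := FeatureGraph.exists_tree (G := G) (L := L) htop
    (by
      intro X
      by_cases h : ∃ s, sort X s ∈ c
      · simp only [G, σ, dif_pos h]
        exact fun e => hbot X (e ▸ h.choose_spec)
      · simp only [G, σ, dif_neg h]
        exact htop)
    (by
      intro X i j hij
      have h := hfeat X _ _ _ (hedge X i) (hij ▸ hedge X j)
      exact (hfin X).toFinset.equivFin.symm.injective (Subtype.ext (Prod.ext hij h)))
    _ (OSFClause.finite_tags c).toFinset le_rfl r ((OSFClause.finite_tags c).mem_toFinset.2 hr)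
  -- The expanded set contains the root and no edge within the tags of `c` leaves it, so
  -- reachability makes it all of them.
  have hBc : ∀ X, X ∈ B ↔ X ∈ OSFClause.tags c := fun X =>
    ⟨fun h => (OSFClause.finite_tags c).mem_toFinset.1 (hs.subset h), fun h => by
      refine hreach (B : Set V) hrB (fun Y f Z hk hY => ?_) h
      obtain ⟨i, -, rfl⟩ := hedge' Y f Z hk
      refine (hs.closed Y hY i).resolve_right fun h => h ?_
      exact (OSFClause.finite_tags c).mem_toFinset.2 ⟨_, hk, Or.inr rfl⟩⟩
  have hfeat_iff : ∀ X f Y, feat X f Y ∈ constraints t ↔ feat X f Y ∈ c := by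
    intro X f Y
    rw [hs.feat_iff]
    constructor
    · rintro ⟨-, i, rfl, rfl⟩
      exact hedge X i
    · exact fun h => ⟨(hBc X).2 ⟨_, h, Or.inl rfl⟩, hedge' X f Y h⟩
  have htags : ∀ X, X ∈ tags t ↔ X ∈ OSFClause.tags c := fun X =>
    ⟨tags_induction t _ (hroot ▸ hr) (fun X f Y hk _ => ⟨_, (hfeat_iff X f Y).1 hk, Or.inr rfl⟩) X,
      fun h => tags_subset_of_mem_constraints (hs.sort_mem X ((hBc X).2 h)) rfl⟩
  refine ⟨t, hn, (Multiset.Nodup.ext (nodup_clause L t) hnodup).2 fun k => ?_, hroot⟩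
  cases k with
  | sort X s =>
    rw [sort_mem_clause hn, htags]
    have key : X ∈ OSFClause.tags c → nodeSort L t X = σ X := fun hX => by
      rcases hn.sort_eq (hs.sort_mem X ((hBc X).2 hX)) with h | h
      · rcases hs.sort_eq X _ (nodeSort_mem (L := L) ((htags X).2 hX)) with h' | h'
        · exact h'
        · exact h'.trans h.symm
      · exact h.symm
    constructor
    · rintro ⟨hX, rfl⟩
      rw [key hX]
      exact hσ X hX
    · intro h
      have hX : X ∈ OSFClause.tags c := ⟨_, h, rfl⟩
      exact ⟨hX, by rw [key hX]; exact huniq X _ _ h (hσ X hX)⟩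
  | eq X Y =>
    exact iff_of_false (fun h => eq_notMem_constraints t X Y (mem_constraints_of_mem_clause h))
      (heq X Y)
  | feat X f Y => rw [feat_mem_clause, hfeat_iff]

end OSFTerm

namespace OSFClause

variable {S F V : Type u} {L : FuzzyLattice S}

open OSFConstraint

theorem mem_solved {c : OSFClause S F V} {k : OSFConstraint S F V} :
    k ∈ solved c ↔ k ∈ c ∧ ¬ k.IsEq := by
  classical
  exact Multiset.mem_filter

theorem eq_of_eqTags {I : Interpretation L F} {α : V → I.Dom} {c : OSFClause S F V}
    (hα : Sat I α c) {X Y : V} (h : EqTags c X Y) : α X = α Y := by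
  induction h with
  | rel X Y h => exact degree_eq_pos.1 (hα _ h)
  | refl X => rfl
  | symm X Y _ ih => exact ih.symm
  | trans X Y Z _ _ ih ih' => exact ih.trans ih'

theorem eq_add_of_pair_le {c : OSFClause S F V} {k k' : OSFConstraint S F V}
    (h : ({k, k'} : OSFClause S F V) ≤ c) : ∃ d, c = d + {k} + {k'} := by
  obtain ⟨d, rfl⟩ := Multiset.le_iff_exists_add.1 h
  refine ⟨d, ?_⟩
  rw [add_assoc, add_comm]
  rfl

open Classical in
/-- The representative of a tag in a normal form. -/
noncomputable def rep (c : OSFClause S F V) (Y : V) : V :=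
  -- Trivial equalities `X ≐ X` must be skipped, since they can persist in a normal form.
  if h : ∃ X, eq X Y ∈ c ∧ X ≠ Y then h.choose else Y

theorem eqTags_rep (c : OSFClause S F V) (Y : V) : EqTags c Y (rep c Y) := by
  rw [rep]
  split_ifs with h
  · exact (Relation.EqvGen.rel _ _ h.choose_spec.1).symm
  · exact Relation.EqvGen.refl _

section NormalForm

variable {c : OSFClause S F V} (hc : ∀ c', ¬ Step L c c')

include hc

theorem not_sort_pair_le (X : V) (s s' : S) :
    ¬ ({sort X s, sort X s'} : OSFClause S F V) ≤ c := by
  intro h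
  obtain ⟨d, rfl⟩ := eq_add_of_pair_le h
  refine hc _ ⟨.sortIntersection d X s s', fun e => ?_⟩
  have := congrArg Multiset.card e
  simp at this

/-- The rule replaces a feature constraint by an equality, so it changes the clause even when `Y =
Y'`. -/
theorem not_feat_pair_le (X : V) (f : F) (Y Y' : V) :
    ¬ ({feat X f Y, feat X f Y'} : OSFClause S F V) ≤ c := by
  intro h
  obtain ⟨d, rfl⟩ := eq_add_of_pair_le h
  refine hc _ ⟨.featureFunctionality d X f Y Y', fun e => ?_⟩
  have := Multiset.singleton_inj.1 (add_left_cancel e)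
  cases this

theorem nodup_solved : (solved c).Nodup := by
  classical
  rw [Multiset.nodup_iff_le]
  intro k hk
  have hk' : ({k, k} : OSFClause S F V) ≤ c := le_trans hk (Multiset.filter_le _ _)
  cases k with
  | sort X s => exact not_sort_pair_le hc X s s hk'
  | eq X Y =>
    exact (mem_solved.1 (Multiset.mem_of_le hk (Multiset.mem_cons_self _ _))).2 trivial
  | feat X f Y => exact not_feat_pair_le hc X f Y Y hk'

theorem sort_unique {X : V} {s s' : S} (h : sort X s ∈ c) (h' : sort X s' ∈ c) : s = s' := by
  by_contra hne
  refine not_sort_pair_le hc X s s' ((Multiset.le_iff_subset (by simp [hne])).2 ?_)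
  intro k hk
  simp only [Multiset.insert_eq_cons, Multiset.mem_cons, Multiset.mem_singleton] at hk
  rcases hk with rfl | rfl <;> assumption

theorem feat_unique {X : V} {f : F} {Y Y' : V} (h : feat X f Y ∈ c) (h' : feat X f Y' ∈ c) :
    Y = Y' := by
  by_contra hne
  refine not_feat_pair_le hc X f Y Y' ((Multiset.le_iff_subset (by simp [hne])).2 ?_)
  intro k hk
  simp only [Multiset.insert_eq_cons, Multiset.mem_cons, Multiset.mem_singleton] at hk
  rcases hk with rfl | rfl <;> assumption

theorem sort_bot_notMem (hi : ¬ Inconsistent L c) (X : V) : sort X L.bot ∉ c := by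
  intro h
  obtain ⟨d, rfl⟩ := Multiset.exists_cons_of_mem h
  rw [← Multiset.singleton_add, add_comm] at hc hi
  refine hc _ ⟨.inconsistentSort d X, fun e => hi ⟨X, e.symm⟩⟩

/-- An eliminated tag occurs in no other constraint of a normal form. -/
theorem notMem_tags_of_eq_mem {X Y : V} (h : eq X Y ∈ c) (hne : X ≠ Y) {k : OSFConstraint S F V}
    (hk : k ∈ c) (hk' : k ≠ eq X Y) : Y ∉ k.tags := by
  classical
  obtain ⟨d, rfl⟩ := Multiset.exists_cons_of_mem h
  intro hY
  have hYd : Y ∈ tags d := ⟨k, (Multiset.mem_cons.1 hk).resolve_left hk', hY⟩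
  rw [← Multiset.singleton_add, add_comm] at hc
  refine hc _ ⟨.tagElimination d X Y hYd, fun e => ?_⟩
  -- An ineffective elimination would leave `Y` in a clause from which it was substituted away.
  rw [← add_right_cancel e] at hYd
  rcases mem_tags_subst hYd with h | h
  · exact hne h.symm
  · exact h.2 rfl

theorem rep_of_mem_tags {k : OSFConstraint S F V} (hk : k ∈ solved c) {Z : V} (hZ : Z ∈ k.tags) :
    rep c Z = Z := by
  rw [rep, dif_neg]
  rintro ⟨X, h, hne⟩
  obtain ⟨hk, hk'⟩ := mem_solved.1 hk
  exact notMem_tags_of_eq_mem hc h hne hk (by rintro rfl; exact hk' trivial) hZ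

/-- The left side of a nontrivial equality is not eliminated by another one, and no tag is
eliminated twice, so representatives are found in one step. -/
theorem rep_eq_rep {X Y : V} (h : eq X Y ∈ c) : rep c X = rep c Y := by
  by_cases hne : X = Y
  · rw [hne]
  · have hX : rep c X = X := by
      rw [rep, dif_neg]
      rintro ⟨X', h', hne'⟩
      refine notMem_tags_of_eq_mem hc h' hne' h ?_ (Or.inl rfl)
      intro e
      cases e
      exact hne rfl
    have hex : ∃ X, eq X Y ∈ c ∧ X ≠ Y := ⟨X, h, hne⟩
    rw [hX, rep, dif_pos hex]
    by_contra hne'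
    refine notMem_tags_of_eq_mem hc h hne hex.choose_spec.1 ?_ (Or.inr rfl)
    intro e
    simp only [eq.injEq, and_true] at e
    exact hne' e.symm

/-- Eliminated tags do not occur in `solved c`, so they may take the values of their
representatives. -/
theorem sat_comp_rep {I : Interpretation L F} {α : V → I.Dom} (hα : Sat I α (solved c)) :
    Sat I (fun Z => α (rep c Z)) c := by
  intro k hk
  by_cases hk' : k.IsEq
  · cases k with
    | eq X Y => exact degree_eq_pos.2 (congrArg α (rep_eq_rep hc hk))
    | sort X s => exact hk'.elim
    | feat X f Y => exact hk'.elim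
  · have hs := mem_solved.2 ⟨hk, hk'⟩
    have e : degree I (fun Z => α (rep c Z)) k = degree I α k :=
      degree_congr fun Z hZ => congrArg α (rep_of_mem_tags hc hs hZ)
    rw [e]
    exact hα k hs

end NormalForm

end OSFClause

/-! ### Unifiers as greatest lower bounds. -/

namespace OSFTerm

variable {S F V : Type u} {L : FuzzyLattice S} {ψ₁ ψ₂ : OSFTerm S F V}

open OSFConstraint OSFClause

theorem tags_clause_subset (t : OSFTerm S F V) : OSFClause.tags (clause L t) ⊆ tags t := by
  rintro X ⟨k, hk, hX⟩
  exact tags_subset_of_mem_constraints (mem_constraints_of_mem_clause hk) hX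

theorem tags_unificationClause_subset (ψ₁ ψ₂ : OSFTerm S F V) :
    OSFClause.tags (unificationClause L ψ₁ ψ₂) ⊆ tags ψ₁ ∪ tags ψ₂ := by
  rw [unificationClause, tags_add, tags_add, tags_singleton]
  refine Set.union_subset (Set.union_subset_union (tags_clause_subset _) (tags_clause_subset _)) ?_
  rintro X (rfl | rfl)
  · exact Or.inl (root_mem_tags _)
  · exact Or.inr (root_mem_tags _)

theorem tags_subset_of_sorted (h₁ : ψ₁.Normal L) (h₂ : ψ₂.Normal L) {U : Set V}
    (hU : Sorted (unificationClause L ψ₁ ψ₂) U) : tags ψ₁ ∪ tags ψ₂ ⊆ U := by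
  refine Set.union_subset (fun X hX => ?_) fun X hX => ?_
  · exact hU (sort X (nodeSort L ψ₁ X)) (Multiset.mem_add.2 (Or.inl (Multiset.mem_add.2
      (Or.inl ((sort_mem_clause h₁).2 ⟨hX, rfl⟩)))))
  · exact hU (sort X (nodeSort L ψ₂ X)) (Multiset.mem_add.2 (Or.inl (Multiset.mem_add.2
      (Or.inr ((sort_mem_clause h₂).2 ⟨hX, rfl⟩)))))

/-- The equality of the roots joins two graphs, each reachable from its own root. -/
theorem tags_subset_of_closed {U : Set V} (hU : Closed (unificationClause L ψ₁ ψ₂) U)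
    (hr : ψ₁.root ∈ U) : tags ψ₁ ∪ tags ψ₂ ⊆ U := by
  have he : ψ₁.root ∈ U ↔ ψ₂.root ∈ U := hU (eq ψ₁.root ψ₂.root) (by simp [unificationClause])
  refine Set.union_subset (tags_induction ψ₁ _ hr fun X f Y hk => ?_)
    (tags_induction ψ₂ _ (he.1 hr) fun X f Y hk => ?_)
  · exact hU (feat X f Y) (Multiset.mem_add.2 (Or.inl (Multiset.mem_add.2
      (Or.inl (feat_mem_clause.2 hk)))))
  · exact hU (feat X f Y) (Multiset.mem_add.2 (Or.inl (Multiset.mem_add.2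
      (Or.inr (feat_mem_clause.2 hk)))))

theorem sat_unificationClause (h₁ : ψ₁.Normal L) (h₂ : ψ₂.Normal L) {I : Interpretation L F}
    {α : V → I.Dom} : Sat I α (unificationClause L ψ₁ ψ₂) ↔
      Sat I α (constraints ψ₁) ∧ Sat I α (constraints ψ₂) ∧ α ψ₁.root = α ψ₂.root := by
  rw [unificationClause, sat_add, sat_add, sat_singleton, degree_eq_pos, sat_clause_iff h₁,
    sat_clause_iff h₂, and_assoc]

/-- A normal common lower bound of two terms without common tags gives a solution of the
unification clause. -/
theorem exists_sat_unificationClause (h₁ : ψ₁.Normal L) (h₂ : ψ₂.Normal L)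
    (hdisj : Disjoint ψ₁.tags ψ₂.tags) {t : OSFTerm S F V} (ht : t.Normal L)
    (ht₁ : 0 < subsumption L t ψ₁) (ht₂ : 0 < subsumption L t ψ₂) :
    ∃ α : V → (canonical t ht).Dom, α ψ₁.root = (t.root, []) ∧
      Sat (canonical t ht) α (unificationClause L ψ₁ ψ₂) := by
  classical
  obtain ⟨α₁, hr₁, hα₁⟩ := (subsumption_pos_iff ht).1 ht₁
  obtain ⟨α₂, hr₂, hα₂⟩ := (subsumption_pos_iff ht).1 ht₂
  -- Disjointness of the tags makes the two solutions compatible.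
  let α : V → (canonical t ht).Dom := fun X => if X ∈ tags ψ₁ then α₁ X else α₂ X
  have e₁ : ∀ X ∈ tags ψ₁, α X = α₁ X := fun X hX => if_pos hX
  have e₂ : ∀ X ∈ tags ψ₂, α X = α₂ X := fun X hX =>
    if_neg fun h => Set.disjoint_left.1 hdisj h hX
  have hr : α ψ₁.root = (t.root, []) := (e₁ _ (root_mem_tags _)).trans hr₁
  refine ⟨α, hr, (sat_unificationClause h₁ h₂).2 ⟨fun k hk => ?_, fun k hk => ?_, ?_⟩⟩
  · rw [degree_congr fun X hX => e₁ X (tags_subset_of_mem_constraints hk hX)]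
    exact hα₁ k hk
  · rw [degree_congr fun X hX => e₂ X (tags_subset_of_mem_constraints hk hX)]
    exact hα₂ k hk
  · exact hr.trans ((e₂ _ (root_mem_tags _)).trans hr₂).symm

theorem isUnifier_leaf_bot (h₁ : ψ₁.Normal L) (h₂ : ψ₂.Normal L)
    (hdisj : Disjoint ψ₁.tags ψ₂.tags) {φ : OSFClause S F V}
    (hsteps : Relation.ReflTransGen (Step L) (unificationClause L ψ₁ ψ₂) φ)
    (hφ : φ.Inconsistent L) (X : V) : IsUnifier L ψ₁ ψ₂ (leaf X L.bot) := by
  refine isUnifier_of_isFuzzyGLB ⟨Or.inr ⟨X, rfl⟩, subsumption_leaf_bot X _,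
    subsumption_leaf_bot X _, fun t ht ht₁ ht₂ => ?_⟩
  rcases ht with ht | ⟨Y, rfl⟩
  · obtain ⟨α, -, hα⟩ := exists_sat_unificationClause h₁ h₂ hdisj ht ht₁ ht₂
    rw [sat_iff_of_steps hsteps] at hα
    obtain ⟨Y, rfl⟩ := hφ
    have := sat_singleton.1 hα
    rw [degree, Interpretation.sort_bot] at this
    exact absurd this (lt_irrefl _)
  · exact subsumption_leaf_bot Y _

theorem exists_isTermOfSolved (h₁ : ψ₁.Normal L) (h₂ : ψ₂.Normal L) {φ : OSFClause S F V}
    (hφ : (unificationClause L ψ₁ ψ₂).NormalizesTo L φ) (hi : ¬ φ.Inconsistent L) :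
    ∃ ψ, IsTermOfSolved L φ ψ₁.root ψ := by
  obtain ⟨hsteps, hnf⟩ := hφ
  have hsub : OSFClause.tags φ.solved ⊆ tags ψ₁ ∪ tags ψ₂ := by
    rintro X ⟨k, hk, hX⟩
    exact tags_unificationClause_subset ψ₁ ψ₂
      (tags_subset_of_steps hsteps ⟨k, (mem_solved.1 hk).1, hX⟩)
  have hrep : ∀ X ∈ OSFClause.tags φ.solved, rep φ X = X := by
    rintro X ⟨k, hk, hX⟩
    exact rep_of_mem_tags hnf hk hX
  -- The tags whose representative has a sort in `φ` form a `Sorted` set; pulled back to the initial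
  -- clause, it contains every tag.
  have hsorted : tags ψ₁ ∪ tags ψ₂ ⊆ {X | ∃ s, sort (rep φ X) s ∈ φ.solved} := by
    refine tags_subset_of_sorted h₁ h₂ (sorted_of_steps hsteps hi fun k hk => ?_)
    cases k with
    | sort X s =>
      have hm : sort X s ∈ φ.solved := mem_solved.2 ⟨hk, id⟩
      exact ⟨s, by rwa [rep_of_mem_tags hnf hm rfl]⟩
    | eq X Y => simp only [Set.mem_ofPred_eq, rep_eq_rep hnf hk]
    | feat X f Y => trivial
  obtain ⟨s₀, hs₀⟩ := hsorted (Or.inl (root_mem_tags ψ₁))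
  obtain ⟨ψ, hn, hcl, hr⟩ := exists_clause_eq (L := L) (c := φ.solved) (r := rep φ ψ₁.root)
    h₁.top_ne_bot (nodup_solved hnf) (fun X Y h => (mem_solved.1 h).2 trivial)
    (fun X h => sort_bot_notMem hnf hi X (mem_solved.1 h).1)
    (fun X s s' h h' => sort_unique hnf (mem_solved.1 h).1 (mem_solved.1 h').1)
    (fun X f Y Y' h h' => feat_unique hnf (mem_solved.1 h).1 (mem_solved.1 h').1)
    (fun X hX => by
      obtain ⟨s, hs⟩ := hsorted (hsub hX)
      exact ⟨s, by rwa [hrep X hX] at hs⟩)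
    ⟨_, hs₀, rfl⟩
    (fun U hrU hU X hX => by
      -- The preimage of `U` under `rep` is closed for `φ`, hence for the initial clause, where
      -- everything is reachable from the root.
      have hcl : tags ψ₁ ∪ tags ψ₂ ⊆ {X | rep φ X ∈ U} := by
        refine tags_subset_of_closed (closed_of_steps hsteps hi fun k hk => ?_) hrU
        cases k with
        | sort X s => trivial
        | eq X Y => simp only [Set.mem_ofPred_eq, rep_eq_rep hnf hk]
        | feat X f Y =>
          have hm : feat X f Y ∈ φ.solved := mem_solved.2 ⟨hk, id⟩
          simp only [Set.mem_ofPred_eq, rep_of_mem_tags hnf hm (Or.inl rfl),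
            rep_of_mem_tags hnf hm (Or.inr rfl)]
          exact hU X f Y hm
      have := hcl (hsub hX)
      rwa [Set.mem_ofPred_eq, hrep X hX] at this)
  exact ⟨ψ, hn, hcl, hr ▸ eqTags_rep φ ψ₁.root⟩

theorem IsTermOfSolved.isUnifier (h₁ : ψ₁.Normal L) (h₂ : ψ₂.Normal L)
    (hdisj : Disjoint ψ₁.tags ψ₂.tags) {φ : OSFClause S F V}
    (hφ : (unificationClause L ψ₁ ψ₂).NormalizesTo L φ) {ψ : OSFTerm S F V}
    (h : IsTermOfSolved L φ ψ₁.root ψ) : IsUnifier L ψ₁ ψ₂ ψ := by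
  obtain ⟨hsteps, hnf⟩ := hφ
  obtain ⟨hn, hcl, hroot⟩ := h
  have hsat : Sat (canonical ψ hn) (fun X => (X, [])) φ.solved := by
    rw [← hcl, sat_clause_iff hn]
    exact sat_canonical ψ hn
  -- The identity on tags solves `Solved(φ)` in `canonical ψ`; through `rep` it solves `φ`, and so
  -- the initial clause.
  have hφsat := sat_comp_rep hnf hsat
  have hrep : rep φ ψ.root = ψ.root := by
    refine rep_of_mem_tags hnf (k := sort ψ.root (nodeSort L ψ ψ.root)) ?_ rfl
    rw [← hcl]
    exact (sort_mem_clause hn).2 ⟨root_mem_tags ψ, rfl⟩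
  have hr₁ := eq_of_eqTags hφsat hroot
  rw [hrep] at hr₁
  obtain ⟨hs₁, hs₂, he⟩ := (sat_unificationClause h₁ h₂).1
    ((sat_iff_of_steps hsteps _ _).2 hφsat)
  refine isUnifier_of_isFuzzyGLB ⟨Or.inl hn, (subsumption_pos_iff hn).2 ⟨_, hr₁, hs₁⟩,
    (subsumption_pos_iff hn).2 ⟨_, he.symm.trans hr₁, hs₂⟩, fun t ht ht₁ ht₂ => ?_⟩
  rcases ht with ht | ⟨Y, rfl⟩
  · obtain ⟨α, hα, hsα⟩ := exists_sat_unificationClause h₁ h₂ hdisj ht ht₁ ht₂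
    rw [sat_iff_of_steps hsteps] at hsα
    refine (subsumption_pos_iff ht).2 ⟨α, (eq_of_eqTags hsα hroot).symm.trans hα, ?_⟩
    rw [← sat_clause_iff hn, hcl]
    exact fun k hk => hsα k (mem_solved.1 hk).1
  · exact subsumption_leaf_bot Y _

end OSFTerm

end FuzzyOSF

theorem mainTheorem6 {S F V : Type u} [Finite S] [Countable V] [Infinite V]
    (L : FuzzyOSF.FuzzyLattice S) (ψ₁ ψ₂ : FuzzyOSF.OSFTerm S F V)
    (h₁ : ψ₁.Normal L) (h₂ : ψ₂.Normal L) (hdisj : Disjoint ψ₁.tags ψ₂.tags) :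
    (FuzzyOSF.OSFTerm.unificationClause L ψ₁ ψ₂).Terminates L ∧
    ∀ φ : FuzzyOSF.OSFClause S F V,
      (FuzzyOSF.OSFTerm.unificationClause L ψ₁ ψ₂).NormalizesTo L φ →
      (∀ X : V, φ.Inconsistent L ↔
        FuzzyOSF.OSFTerm.IsUnifier L ψ₁ ψ₂ (FuzzyOSF.OSFTerm.leaf X L.bot)) ∧
      (¬ φ.Inconsistent L →
        (∃ ψ, FuzzyOSF.OSFTerm.IsTermOfSolved L φ ψ₁.root ψ) ∧
        ∀ ψ, FuzzyOSF.OSFTerm.IsTermOfSolved L φ ψ₁.root ψ →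
          FuzzyOSF.OSFTerm.IsUnifier L ψ₁ ψ₂ ψ) := by
  refine ⟨FuzzyOSF.OSFClause.terminates _, fun φ hφ => ⟨fun X => ⟨fun hi =>
    FuzzyOSF.OSFTerm.isUnifier_leaf_bot h₁ h₂ hdisj hφ.1 hi X, fun hX => ?_⟩, fun hi =>
    ⟨FuzzyOSF.OSFTerm.exists_isTermOfSolved h₁ h₂ hφ hi, fun ψ hψ =>
      hψ.isUnifier h₁ h₂ hdisj hφ⟩⟩⟩
  -- For consistent `φ`, the normal lower bound `ψ` would lie positively below `X : ⊥`.
  by_contra hi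
  obtain ⟨ψ, hψ⟩ := FuzzyOSF.OSFTerm.exists_isTermOfSolved h₁ h₂ hφ hi
  have hU := (hψ.isUnifier h₁ h₂ hdisj hφ).1
  exact FuzzyOSF.OSFTerm.not_subsumption_leaf_bot hψ.1 X
    (hX.1.2.2.2 ψ hU.1 hU.2.1 hU.2.2.1)
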